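/- Let $k$ be an algebraically closed field of arbitrary characteristic, $n\ge 0$ an integer, and let $g=n/2$ if $n$ is even and $g=(n+1)/2$ if $n$ is odd. Let $X$ be a closed subscheme of $\mathbb{A}^N_k$ with ideal $I_X=(f_1,\dots,f_m)$. Write $\mathcal{L}_n(X)$ for the set of $n$-jets on $X$ (morphisms $\mathrm{Spec}\,k[t]/(t^{n+1})\to X$), viewed inside the affine space $\mathcal{L}_n(\mathbb{A}^N)=k^{N(n+1)}$ with its Zariski topology, and $\pi^n_l:\mathcal{L}_n(\mathbb{A}^N)\to\mathcal{L}_l(\mathbb{A}^N)$, $l\le n$, for the truncation maps. For $\theta\in\mathcal{L}_n(\mathbb{A}^N)$ let $e_1(\theta)\le\dots\le e_N(\theta)\le n+1$ be the unique sequence in $\mathbb{N}$ such that the quotient of $(k[[t]]/(t^{n+1}))^N$ by the $k[[t]]$-submodule generated by the rows of the Jacobian matrix $\left(\frac{\partial f_i}{\partial x_j}(\theta)\right)_{i,j}$ is isomorphic to $\bigoplus_{i=1}^N k[[t]]/(t^{e_i(\theta)})$. For integers $0\le e_1\le\dots\le e_b<g$ with $b\le N$, let $\mathcal{L}_n^{e_1,\dots,e_b}(X)$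 be the set of all $\theta\in\mathcal{L}_n(X)$ with $e_i(\theta)=e_i$ for $1\le i\le b$ and, if $b<N$, $e_{b+1}(\theta)\ge g$. (For $\theta\in\mathcal{L}_n(X)$ the $e_i(\theta)$ do not depend on the chosen generators of $I_X$.) Locally closed subsets of affine spaces are regarded as (reduced) varieties, and fibrations are (locally) trivial in the Zariski topology. Let $0\le e_1\le e_2\le\dots\le e_b<g$ be integers, with $b\le m$ and $b\le N$. Then: (a) For $l\in\{n-g,\dots,n\}$, the set $\pi^n_l(\mathcal{L}_n^{e_1,\dots,e_b}(X))$ is locally closed. (b) For every $\gamma\in\pi^n_{n-g}(\mathcal{L}_n^{e_1,\dots,e_b}(X))$ there exists an open subset $U_{n-g}$ of $\pi^n_{n-g}(\mathcal{L}_n^{e_1,\dots,e_b}(X))$ containing $\gamma$ such that, if $U_i$ denotes the inverse image of $U_{n-g}$ under the truncation map $\pi^n_i(\mathcal{L}_n^{e_1,\dots,e_b}(X))\to\pi^n_{n-g}(\mathcal{L}_n^{e_1,\dots,e_b}(X))$ for $i\in\{n-g+1,\dots,n\}$, then for every $l\in\{n-g,\dots,n-1\}$ the truncation map $U_{l+1}\to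 U_l$ is a trivial fibration with fibre $\mathbb{A}^{N-a}$, where $a$ is the largest number in $\{0,\dots,b\}$ satisfying $e_a<n-l$ (with the convention $e_0=0$). (c) For $n>l\ge n-g$, the truncation map $\mathcal{L}_n^{e_1,\dots,e_b}(X)\to\pi^n_l(\mathcal{L}_n^{e_1,\dots,e_b}(X))$ is a locally trivial fibration with fibre an affine space. If $l=n-g$, the dimension of this fibre is at least $\lceil (N-b)(n/2)\rceil$, and if moreover $e_1+\dots+e_b\ge n/2$, then it is at least $\lceil (N-b+1)(n/2)\rceil$. (d) Let $\theta\in\mathcal{L}_n^{e_1,\dots,e_b}(X)$, and let $M$ be a closed subscheme of $\mathbb{A}^N$ defined by $b$ elements of $I_X$ such that $\theta\in\mathcal{L}_n^{e_1,\dots,e_b}(M)$. If $\alpha\in\mathcal{L}_n^{e_1,\dots,e_b}(M)$ satisfies $\pi^n_{n-g}(\alpha)=\pi^n_{n-g}(\theta)$, then $\alpha\in\mathcal{L}_n^{e_1,\dots,e_b}(X)$. -/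

import Mathlib

noncomputable section

namespace JetTrunc

/-! ### Classical varieties over a field: subsets of affine spaces `σ → k` -/

section Varieties

variable {k : Type*} [Field k] {σ τ : Type*}

/-- Zariski open subsets of the affine space `σ → k`. -/
def IsZariskiOpen (U : Set (σ → k)) : Prop :=
  ∃ S : Set (MvPolynomial σ k), U = {x | ∃ p ∈ S, MvPolynomial.eval x p ≠ 0}

/-- Zariski locally closed subsets: intersections of an open and a closed subset. -/
def IsZariskiLocallyClosed (V : Set (σ → k)) : Prop :=
  ∃ U C : Set (σ → k), IsZariskiOpen U ∧ IsZariskiOpen Cᶜ ∧ V = U ∩ C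

/-- `φ` is a regular function on `V`: near every point of `V` it is a quotient of polynomials. -/
def IsRegularFunOn (φ : (σ → k) → k) (V : Set (σ → k)) : Prop :=
  ∀ x ∈ V, ∃ p q : MvPolynomial σ k, MvPolynomial.eval x q ≠ 0 ∧
    ∀ y ∈ V, MvPolynomial.eval y q ≠ 0 → φ y = MvPolynomial.eval y p / MvPolynomial.eval y q

/-- `Φ` restricts to a regular map `V → W`. -/
def IsRegularMap (Φ : (σ → k) → (τ → k)) (V : Set (σ → k)) (W : Set (τ → k)) : Prop :=
  Set.MapsTo Φ V W ∧ ∀ j, IsRegularFunOn (fun x => Φ x j) V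

/-- The product `U × 𝔸^d`, as a subset of the affine space with coordinates `τ ⊕ Fin d`. -/
def prodAffine (U : Set (τ → k)) (d : ℕ) : Set (τ ⊕ Fin d → k) :=
  {w | (fun j => w (Sum.inl j)) ∈ U}

/-- `π : V → U` is a trivial fibration with fibre `𝔸^d`: there is an isomorphism of varieties
`V ≅ U × 𝔸^d` over `U`. -/
def IsTrivialFibration (π : (σ → k) → (τ → k)) (V : Set (σ → k)) (U : Set (τ → k))
    (d : ℕ) : Prop :=
  ∃ (Φ : (σ → k) → (τ ⊕ Fin d → k)) (Ψ : (τ ⊕ Fin d → k) → (σ → k)),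
    IsRegularMap Φ V (prodAffine U d) ∧ IsRegularMap Ψ (prodAffine U d) V ∧
    Set.LeftInvOn Ψ Φ V ∧ Set.RightInvOn Ψ Φ (prodAffine U d) ∧
    ∀ x ∈ V, (fun j => Φ x (Sum.inl j)) = π x

/-- `π : V → W` is a (Zariski) locally trivial fibration with fibre `𝔸^d`. -/
def IsLocallyTrivialFibration (π : (σ → k) → (τ → k)) (V : Set (σ → k)) (W : Set (τ → k))
    (d : ℕ) : Prop :=
  Set.MapsTo π V W ∧ ∀ w ∈ W, ∃ O : Set (τ → k), IsZariskiOpen O ∧ w ∈ O ∧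
    IsTrivialFibration π (V ∩ π ⁻¹' O) (W ∩ O) d

end Varieties

/-! ### Jets -/

section Jets

variable {k : Type*} [Field k] {N : ℕ}

/-- The truncated ring `k⟦t⟧ / (t^s)`. -/
abbrev TruncRing (k : Type*) [Field k] (s : ℕ) : Type _ :=
  PowerSeries k ⧸ Ideal.span {(PowerSeries.X : PowerSeries k) ^ s}

/-- The (closed points of the) space of `n`-jets of `𝔸^N`, in the coordinates `a_{i,j}`,
`1 ≤ i ≤ N`, `0 ≤ j ≤ n`; it is itself an affine space. -/
abbrev Jet (k : Type*) (N n : ℕ) : Type _ := Fin N × Fin (n + 1) → k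

/-- The `N`-tuple `(∑_j a_{i,j} t^j)_i` of elements of `k⟦t⟧ / (t^(n+1))` given by a jet. -/
def Jet.toTuple {n : ℕ} (θ : Jet k N n) : Fin N → TruncRing k (n + 1) := fun i =>
  Ideal.Quotient.mk _
    (∑ j : Fin (n + 1), PowerSeries.C (θ (i, j)) * (PowerSeries.X : PowerSeries k) ^ (j : ℕ))

/-- The truncation map `π^n_l` from `n`-jets to `l`-jets, `l ≤ n`. -/
def Jet.trunc {l n : ℕ} (h : l ≤ n) (θ : Jet k N n) : Jet k N l :=
  fun p => θ (p.1, Fin.castLE (Nat.succ_le_succ h) p.2)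

/-- The set of `n`-jets on the closed subscheme of `𝔸^N` with ideal `I`. -/
def jetsOn (n : ℕ) (I : Ideal (MvPolynomial (Fin N) k)) : Set (Jet k N n) :=
  {θ | ∀ p ∈ I, MvPolynomial.aeval θ.toTuple p = 0}

/-- The submodule of `(k⟦t⟧ / (t^(n+1)))^N` generated over `k⟦t⟧` by the rows of the Jacobian
matrix `(∂f_i/∂x_j (θ))`. -/
def rowModule {m n : ℕ} (f : Fin m → MvPolynomial (Fin N) k) (θ : Jet k N n) :
    Submodule (PowerSeries k) (Fin N → TruncRing k (n + 1)) :=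
  Submodule.span (PowerSeries k)
    (Set.range fun i : Fin m => fun j : Fin N =>
      MvPolynomial.aeval θ.toTuple (MvPolynomial.pderiv j (f i)))

/-- `E` is the sequence `e_1 ≤ ⋯ ≤ e_N ≤ n + 1` of invariants of `θ` with respect to `f`, i.e.
`(k⟦t⟧/(t^(n+1)))^N / (rows) ≅ k⟦t⟧/(t^(e_1)) ⊕ ⋯ ⊕ k⟦t⟧/(t^(e_N))`. -/
def IsInvariantSeq {m n : ℕ} (f : Fin m → MvPolynomial (Fin N) k) (θ : Jet k N n)
    (E : Fin N → ℕ) : Prop :=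
  Monotone E ∧ (∀ i, E i ≤ n + 1) ∧
    Nonempty (((Fin N → TruncRing k (n + 1)) ⧸ rowModule f θ) ≃ₗ[PowerSeries k]
      ((i : Fin N) → TruncRing k (E i)))

/-- The number `g`: `n / 2` for even `n` and `(n + 1) / 2` for odd `n`. -/
def gNum (n : ℕ) : ℕ := if Even n then n / 2 else (n + 1) / 2

/-- The jets `θ` of `𝔸^N` with `e_i(f; θ) = e_i` for `1 ≤ i ≤ b` and `e_{b+1}(f; θ) ≥ g` if
`b < N`. -/
def invariantStratum {m b : ℕ} (n : ℕ) (f : Fin m → MvPolynomial (Fin N) k) (e : Fin b → ℕ) :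
    Set (Jet k N n) :=
  {θ | ∃ E : Fin N → ℕ, IsInvariantSeq f θ E ∧
    (∀ (i : Fin N) (h : (i : ℕ) < b), E i = e ⟨i, h⟩) ∧
    ∀ h : b < N, gNum n ≤ E ⟨b, h⟩}

/-- The set `L_n^{e_1,…,e_b}(X)` for the closed subscheme `X` of `𝔸^N` with ideal
`(f_1, …, f_m)`. -/
def jetStratum {m b : ℕ} (n : ℕ) (f : Fin m → MvPolynomial (Fin N) k) (e : Fin b → ℕ) :
    Set (Jet k N n) :=
  jetsOn n (Ideal.span (Set.range f)) ∩ invariantStratum n f e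

/-- The image `π^n_l (L_n^{e_1,…,e_b}(X))`. -/
def truncStratum {m b l n : ℕ} (h : l ≤ n) (f : Fin m → MvPolynomial (Fin N) k)
    (e : Fin b → ℕ) : Set (Jet k N l) :=
  Jet.trunc h '' jetStratum n f e

end Jets

end JetTrunc

end

open JetTrunc

/-!
A jet `θ` of level `n` over a jet `η` of level `l ≥ n - g` is `η + t^(l+1) u`, and as
`2 (l + 1) ≥ n + 1`, Taylor expansion to first order turns the equations of `X` for `θ` into the
equations of `X` for `η` together with a linear system `J(η) u = -F(η)` over `k⟦t⟧/(t^(n-l))`, where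
`J` is the Jacobian matrix (`mem_jetsOn_iff_linear`). Written in coefficients, it is a linear system
over `k` whose matrix, a block Toeplitz matrix, depends polynomially on the truncation of `η` to
level `n - g`.

The invariants `e_i < g` are equivalent to the ranks over `k` of the Toeplitz matrices of `J` modulo
`t^s`, `s ≤ g` (`mem_invariantStratum_iff`): the kernel of such a matrix is the space of
homomorphisms from the cokernel of `Jᵀ` to `k⟦t⟧/(t^s)`, which has dimension `∑ min (e_i, s)`.
Therefore the matrices of the linear systems have constant rank on a stratum.

Local closedness follows, since solvability of a linear system whose matrix has a prescribed rank is
a rank condition on the augmented matrix (`isZariskiLocallyClosed_truncStratum`). The truncation map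
between two levels `l ≤ l'` has as fibres the projections of the solution sets to the unknowns of
degree at most `l'`. Because of the constant ranks, these affine spaces have constant dimension, and
near a given point they are trivialized by a fixed linear map whose inverse is rational
(`exists_uniform_parametrization`, `exists_isTrivialFibration`). Finally, replacing `X` by a scheme
`M ⊇ X` can only enlarge the kernel of the linear system; on jets with the same invariants the
kernels coincide, and hence so do the lifts (`mem_jetStratum_of_trunc_eq`).
-/

namespace JetTrunc

/-! ### Linear systems of constant rank -/

section LinearAlgebra

open MvPolynomial

variable {k : Type*} [Field k]

/-- Rank factorization: a matrix of rank `r` becomes the identity of size `r` after multiplication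
by suitable matrices on both sides. -/
theorem exists_mul_mul_eq_one {p ι : Type*} [Fintype p] [Fintype ι] [DecidableEq p] [DecidableEq ι]
    (D : Matrix p ι k) :
    ∃ (L : Matrix (Fin D.rank) p k) (P : Matrix ι (Fin D.rank) k), L * D * P = 1 := by
  have e : LinearMap.range D.mulVecLin ≃ₗ[k] (Fin D.rank → k) :=
    LinearEquiv.ofFinrankEq _ _ (by simp only [Module.finrank_fin_fun]; rfl)
  obtain ⟨l, hl⟩ := LinearMap.exists_extend e.toLinearMap
  obtain ⟨s, hs⟩ := (e.toLinearMap ∘ₗ D.mulVecLin.rangeRestrict).exists_rightInverse_of_surjective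
    (by
      rw [LinearMap.range_comp, LinearMap.range_rangeRestrict, Submodule.map_top,
        LinearEquiv.range])
  refine ⟨LinearMap.toMatrix' l, LinearMap.toMatrix' s, ?_⟩
  apply Matrix.toLin'.injective
  rw [Matrix.toLin'_mul, Matrix.toLin'_mul, Matrix.toLin'_toMatrix', Matrix.toLin'_toMatrix',
    Matrix.toLin'_one]
  rw [← hs, ← hl]
  rfl

/-- Near a point `γ`, a family `D` of matrices with polynomial entries has rank at least the rank
at `γ`; and on the locus where the rank equals that at `γ`, it has a generalized inverse `q⁻¹ Z`
with polynomial `q`, `Z`. -/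
theorem exists_generalizedInverse {p ι τ : Type*} [Fintype p] [Fintype ι] [DecidableEq p]
    [DecidableEq ι] (D : Matrix p ι (MvPolynomial τ k)) (γ : τ → k) :
    ∃ (q : MvPolynomial τ k) (Z : Matrix ι p (MvPolynomial τ k)), eval γ q ≠ 0 ∧
      ∀ x, eval x q ≠ 0 → (D.map (eval γ)).rank ≤ (D.map (eval x)).rank ∧
        ((D.map (eval x)).rank = (D.map (eval γ)).rank → ∀ u,
          (D.map (eval x)).mulVec ((eval x q)⁻¹ •
            (Z.map (eval x)).mulVec ((D.map (eval x)).mulVec u)) = (D.map (eval x)).mulVec u) := by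
  obtain ⟨L, P, h⟩ := exists_mul_mul_eq_one (D.map (eval γ))
  obtain ⟨c, hc⟩ : ∃ c : k →+* MvPolynomial τ k, ∀ x a, eval x (c a) = a := ⟨C, by simp⟩
  have hL : ∀ x : τ → k, (L.map c).map (eval x) = L := fun x => by ext; simp [hc]
  have hP : ∀ x : τ → k, (P.map c).map (eval x) = P := fun x => by ext; simp [hc]
  have hM : ∀ x, (L.map c * D * P.map c).map (eval x) = L * D.map (eval x) * P := by
    intro x
    rw [Matrix.map_mul, Matrix.map_mul, hL, hP]
  have hdet : ∀ x, eval x (L.map c * D * P.map c).det = (L * D.map (eval x) * P).det := by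
    intro x
    rw [← hM, RingHom.map_det]; rfl
  refine ⟨(L.map c * D * P.map c).det, P.map c * (L.map c * D * P.map c).adjugate * L.map c,
    by rw [hdet, h]; simp, fun x hx => ?_⟩
  rw [hdet] at hx
  set M := L * D.map (eval x) * P with hMdef
  have hMr : M.rank = (D.map (eval γ)).rank := by
    rw [Matrix.rank_of_isUnit M ((Matrix.isUnit_iff_isUnit_det M).2 hx.isUnit)]; simp
  refine ⟨?_, fun hr u => ?_⟩
  · calc _ = M.rank := hMr.symm
      _ ≤ (L * D.map (eval x)).rank := Matrix.rank_mul_le_left _ _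
      _ ≤ _ := Matrix.rank_mul_le_right _ _
  -- `D(x) P` has the same column space as `D(x)`, since it has at least the same rank.
  have hrange : LinearMap.range (D.map (eval x) * P).mulVecLin =
      LinearMap.range (D.map (eval x)).mulVecLin := by
    apply Submodule.eq_of_le_of_finrank_le
    · rw [Matrix.mulVecLin_mul]; exact LinearMap.range_comp_le_range _ _
    · change (D.map (eval x)).rank ≤ (D.map (eval x) * P).rank
      refine hr.trans_le (hMr.symm.trans_le ?_)
      rw [hMdef, Matrix.mul_assoc]
      exact Matrix.rank_mul_le_right _ _
  have hu : (D.map (eval x)).mulVec u ∈ LinearMap.range (D.map (eval x) * P).mulVecLin := by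
    rw [hrange]; exact ⟨u, rfl⟩
  obtain ⟨z, hz⟩ := hu
  rw [Matrix.mulVecLin_apply] at hz
  have hZ : (P.map c * (L.map c * D * P.map c).adjugate * L.map c).map (eval x) =
      P * M.adjugate * L := by
    rw [Matrix.map_mul, Matrix.map_mul, hL, hP]
    congr 2
    have := RingHom.map_adjugate (eval x) (L.map c * D * P.map c)
    simp only [RingHom.mapMatrix_apply] at this
    rw [this, hM]
  rw [hZ, hdet, ← hz, Matrix.mulVec_mulVec]
  have : P * M.adjugate * L * (D.map (eval x) * P) = M.det • P := by
    have : P * M.adjugate * L * (D.map (eval x) * P) = P * (M.adjugate * M) := by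
      rw [hMdef]; simp only [Matrix.mul_assoc]
    rw [this, Matrix.adjugate_mul]; simp
  rw [this, Matrix.smul_mulVec, smul_smul, inv_mul_cancel₀ hx, one_smul, Matrix.mulVec_mulVec]

variable {p ι₀ ι₁ : Type*} [Fintype ι₀] [Fintype ι₁]

/-- The projection to the first unknown of the solutions `(w, v)` of the homogeneous linear system
`B₀ w + B₁ v = 0`. -/
def kerProj (B₀ : Matrix p ι₀ k) (B₁ : Matrix p ι₁ k) : Submodule k (ι₀ → k) :=
  (LinearMap.range B₁.mulVecLin).comap B₀.mulVecLin

theorem finrank_kerProj (B₀ : Matrix p ι₀ k) (B₁ : Matrix p ι₁ k) :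
    Module.finrank k (kerProj B₀ B₁) + (Matrix.fromCols B₀ B₁).rank =
      Fintype.card ι₀ + B₁.rank := by
  -- `kerProj` is the kernel of the map from the first unknown to `kᵖ` modulo the image of `B₁`,
  -- whose image is the image of `(B₀ | B₁)` modulo that of `B₁`.
  set R := LinearMap.range B₁.mulVecLin with hR
  set S := LinearMap.range (Matrix.fromCols B₀ B₁).mulVecLin with hS
  have hS' : S = LinearMap.range B₀.mulVecLin ⊔ R := by
    apply le_antisymm
    · rintro _ ⟨u, rfl⟩
      rw [Matrix.mulVecLin_apply, Matrix.fromCols_mulVec]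
      exact Submodule.add_mem_sup ⟨_, rfl⟩ ⟨_, rfl⟩
    · apply sup_le
      · rintro _ ⟨w, rfl⟩
        exact ⟨Sum.elim w 0, by simp [Matrix.fromCols_mulVec]⟩
      · rintro _ ⟨v, rfl⟩
        exact ⟨Sum.elim 0 v, by simp [Matrix.fromCols_mulVec]⟩
  have h1 := LinearMap.finrank_range_add_finrank_ker (R.mkQ ∘ₗ B₀.mulVecLin)
  have h2 : LinearMap.ker (R.mkQ ∘ₗ B₀.mulVecLin) = kerProj B₀ B₁ := by
    rw [LinearMap.ker_comp, Submodule.ker_mkQ]; rfl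
  have h3 : LinearMap.range (R.mkQ ∘ₗ B₀.mulVecLin) = S.map R.mkQ := by
    rw [LinearMap.range_comp, hS', Submodule.map_sup]
    rw [show R.map R.mkQ = ⊥ by simp, sup_bot_eq]
  have h4 := LinearMap.finrank_range_add_finrank_ker (R.mkQ.domRestrict S)
  have hRS : R ≤ S := hS' ▸ le_sup_right
  have h5 : Module.finrank k (LinearMap.ker (R.mkQ.domRestrict S)) = Module.finrank k R := by
    rw [← (Submodule.submoduleOfEquivOfLe hRS).finrank_eq, LinearMap.ker_domRestrict,
      Submodule.ker_mkQ]
    rfl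
  rw [h2, h3] at h1
  rw [LinearMap.range_domRestrict] at h4
  simp only [Module.finrank_fintype_fun_eq_card] at h1
  rw [h5] at h4
  change _ + Module.finrank k S = _ + Module.finrank k R
  omega

/-- The rank of the linear system `B₀ w + B₁ v = F`, `T w = c` is maximal if and only if `T` is
injective on `kerProj B₀ B₁`; in that case the equation `T w = c` may be added to any solvable
system `B₀ w + B₁ v = F`. -/
theorem rank_fromBlocks_eq [Fintype p] {d : ℕ} (B₀ : Matrix p ι₀ k) (B₁ : Matrix p ι₁ k)
    (T : Matrix (Fin d) ι₀ k) (hK : Module.finrank k (kerProj B₀ B₁) = d) :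
    (Matrix.fromBlocks B₀ B₁ T 0).rank ≤ (Matrix.fromCols B₀ B₁).rank + d ∧
    ((∀ w ∈ kerProj B₀ B₁, T.mulVec w = 0 → w = 0) →
      (Matrix.fromBlocks B₀ B₁ T 0).rank = (Matrix.fromCols B₀ B₁).rank + d) ∧
    ((Matrix.fromBlocks B₀ B₁ T 0).rank = (Matrix.fromCols B₀ B₁).rank + d →
      (∀ w ∈ kerProj B₀ B₁, T.mulVec w = 0 → w = 0) ∧
      ∀ w v c, ∃ w' v', B₀.mulVec w' + B₁.mulVec v' = B₀.mulVec w + B₁.mulVec v ∧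
        T.mulVec w' = c) := by
  set S := LinearMap.range (Matrix.fromCols B₀ B₁).mulVecLin with hS
  let ε := LinearEquiv.sumArrowLequivProdArrow p (Fin d) k k
  set R := (S.prod (⊤ : Submodule k (Fin d → k))).map ε.symm.toLinearMap with hR
  have hRmem : ∀ y, y ∈ R ↔ (y ∘ Sum.inl) ∈ S := by
    intro y
    rw [hR, Submodule.mem_map_equiv]
    simp only [LinearEquiv.symm_symm, Submodule.mem_prod, Submodule.mem_top, and_true]
    rfl
  have hRrank : Module.finrank k R = (Matrix.fromCols B₀ B₁).rank + d := by
    have h1 : S.prod (⊤ : Submodule k (Fin d → k)) =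
        LinearMap.range (S.subtype.prodMap (LinearMap.id : (Fin d → k) →ₗ[k] _)) := by
      rw [LinearMap.range_prodMap, Submodule.range_subtype, LinearMap.range_id]
    rw [hR, LinearEquiv.finrank_map_eq, h1, LinearMap.finrank_range_of_inj
      (Prod.map_injective.2 ⟨S.injective_subtype, Function.injective_id⟩)]
    simp only [Module.finrank_prod, Module.finrank_fin_fun]
    rfl
  set D := Matrix.fromBlocks B₀ B₁ T 0 with hD
  have hDv : ∀ w v, D.mulVec (Sum.elim w v) =
      Sum.elim (B₀.mulVec w + B₁.mulVec v) (T.mulVec w) := by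
    intro w v; simp [hD, Matrix.fromBlocks_mulVec]
  have helim : ∀ u : ι₀ ⊕ ι₁ → k, u = Sum.elim (u ∘ Sum.inl) (u ∘ Sum.inr) := by
    intro u; simp
  have hle : LinearMap.range D.mulVecLin ≤ R := by
    rintro _ ⟨u, rfl⟩
    rw [hRmem]
    refine ⟨u, ?_⟩
    rw [Matrix.mulVecLin_apply, Matrix.mulVecLin_apply, helim u, hDv, Matrix.fromCols_mulVec]
    simp
  let TK : kerProj B₀ B₁ →ₗ[k] (Fin d → k) := T.mulVecLin.domRestrict _
  have hTK : Function.Injective TK ↔ Function.Surjective TK :=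
    LinearMap.injective_iff_surjective_of_finrank_eq_finrank (by simp [hK])
  have hinj : Function.Injective TK ↔ ∀ w ∈ kerProj B₀ B₁, T.mulVec w = 0 → w = 0 := by
    rw [injective_iff_map_eq_zero]
    exact ⟨fun h w hw h0 => congrArg Subtype.val (h ⟨w, hw⟩ h0),
      fun h w h0 => Subtype.ext (h w w.2 h0)⟩
  refine ⟨hRrank ▸ Submodule.finrank_mono hle, fun h => ?_, fun h => ?_⟩
  · rw [← hRrank]
    change Module.finrank k (LinearMap.range D.mulVecLin) = _
    suffices hRD : R ≤ LinearMap.range D.mulVecLin by rw [le_antisymm hle hRD]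
    intro y hy
    obtain ⟨u, hu⟩ := (hRmem y).1 hy
    obtain ⟨⟨w, v, hv⟩, hw⟩ := hTK.1 (hinj.2 h) (y ∘ Sum.inr - T.mulVec (u ∘ Sum.inl))
    change T.mulVec w = _ at hw
    change B₁.mulVec v = B₀.mulVec w at hv
    refine ⟨Sum.elim (u ∘ Sum.inl + w) (u ∘ Sum.inr - v), ?_⟩
    rw [Matrix.mulVecLin_apply, helim u, Matrix.fromCols_mulVec] at hu
    rw [Matrix.mulVecLin_apply, hDv, Matrix.mulVec_add, Matrix.mulVec_sub, Matrix.mulVec_add, hv,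
      hw]
    ext (i | i)
    · have := congrFun hu i
      simp only [Sum.elim_comp_inl, Sum.elim_comp_inr, Function.comp_apply, Pi.add_apply] at this
      rw [← this]
      simp
    · simp
  · have hDR : LinearMap.range D.mulVecLin = R :=
      Submodule.eq_of_le_of_finrank_eq hle (by rw [hRrank, ← h]; rfl)
    have hsol : ∀ w v c, ∃ w' v', B₀.mulVec w' + B₁.mulVec v' = B₀.mulVec w + B₁.mulVec v ∧
        T.mulVec w' = c := by
      intro w v c
      have : Sum.elim (B₀.mulVec w + B₁.mulVec v) c ∈ R := by
        rw [hRmem]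
        exact ⟨Sum.elim w v, by simp [Matrix.fromCols_mulVec]⟩
      rw [← hDR] at this
      obtain ⟨u, hu⟩ := this
      rw [Matrix.mulVecLin_apply, helim u, hDv, Sum.elim_eq_iff] at hu
      exact ⟨_, _, hu⟩
    refine ⟨hinj.1 (hTK.2 fun c => ?_), hsol⟩
    obtain ⟨w, v, h1, h2⟩ := hsol 0 0 c
    refine ⟨⟨w, -v, ?_⟩, h2⟩
    rw [Matrix.mulVecLin_apply, Matrix.mulVecLin_apply, Matrix.mulVec_neg]
    simp only [Matrix.mulVec_zero, add_zero] at h1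
    exact (eq_neg_of_add_eq_zero_left h1).symm

/-- Uniform parametrization of the first unknown `w` of the solutions of `B₀ w + B₁ v = F`, where
`B₀`, `B₁` are families of matrices with polynomial entries. Near a point `γ`, on the locus where
`B₁` and `(B₀ | B₁)` keep their ranks, a fixed linear map `T` is a bijection from these `w` to a
coordinate space, and its inverse is rational in the parameter and linear in `F`. -/
theorem exists_uniform_parametrization [Fintype p] [DecidableEq p] [DecidableEq ι₀]
    [DecidableEq ι₁] {τ : Type*} (B₀ : Matrix p ι₀ (MvPolynomial τ k))
    (B₁ : Matrix p ι₁ (MvPolynomial τ k)) (γ : τ → k) {d r r₁ : ℕ}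
    (hr₁ : (B₁.map (eval γ)).rank = r₁)
    (hr : (Matrix.fromCols (B₀.map (eval γ)) (B₁.map (eval γ))).rank = r)
    (hd : d + r = Fintype.card ι₀ + r₁) :
    ∃ (q : MvPolynomial τ k) (Z : Matrix ι₀ (p ⊕ Fin d) (MvPolynomial τ k))
      (T : Matrix (Fin d) ι₀ k), eval γ q ≠ 0 ∧
      ∀ x, eval x q ≠ 0 → (B₁.map (eval x)).rank = r₁ →
        (Matrix.fromCols (B₀.map (eval x)) (B₁.map (eval x))).rank = r →
        ∀ F w v, (B₀.map (eval x)).mulVec w + (B₁.map (eval x)).mulVec v = F →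
          (∀ c, T.mulVec ((eval x q)⁻¹ • (Z.map (eval x)).mulVec (Sum.elim F c)) = c ∧
            ∃ v', (B₀.map (eval x)).mulVec
              ((eval x q)⁻¹ • (Z.map (eval x)).mulVec (Sum.elim F c)) +
              (B₁.map (eval x)).mulVec v' = F) ∧
          (eval x q)⁻¹ • (Z.map (eval x)).mulVec (Sum.elim F (T.mulVec w)) = w := by
  have hK : ∀ x, (B₁.map (eval x)).rank = r₁ →
      (Matrix.fromCols (B₀.map (eval x)) (B₁.map (eval x))).rank = r →
      Module.finrank k (kerProj (B₀.map (eval x)) (B₁.map (eval x))) = d := by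
    intro x h1 h2
    have := finrank_kerProj (B₀.map (eval x)) (B₁.map (eval x))
    omega
  -- `T` extends an isomorphism of `kerProj` at `γ` with `kᵈ`.
  obtain ⟨t, ht⟩ := LinearMap.exists_extend (LinearEquiv.ofFinrankEq
    (kerProj (B₀.map (eval γ)) (B₁.map (eval γ))) (Fin d → k) (by simp [hK γ hr₁ hr])).toLinearMap
  obtain ⟨T, rfl⟩ : ∃ T : Matrix (Fin d) ι₀ k, t = T.mulVecLin :=
    ⟨LinearMap.toMatrix' t, by rw [← Matrix.toLin'_apply', Matrix.toLin'_toMatrix']⟩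
  have hT : ∀ w ∈ kerProj (B₀.map (eval γ)) (B₁.map (eval γ)), T.mulVec w = 0 → w = 0 := by
    intro w hw h0
    have h1 := LinearMap.congr_fun ht ⟨w, hw⟩
    change T.mulVec w = _ at h1
    rw [h0] at h1
    exact congrArg Subtype.val ((LinearEquiv.map_eq_zero_iff _).1 h1.symm)
  have hDx : ∀ x, (Matrix.fromBlocks B₀ B₁ (T.map C) 0).map (eval x) =
      Matrix.fromBlocks (B₀.map (eval x)) (B₁.map (eval x)) T 0 := by
    intro x
    rw [Matrix.fromBlocks_map]
    congr 1
    ext; simp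
  obtain ⟨q, Z, hq, H⟩ := exists_generalizedInverse (Matrix.fromBlocks B₀ B₁ (T.map C) 0) γ
  have hDγ := (rank_fromBlocks_eq _ _ T (hK γ hr₁ hr)).2.1 hT
  refine ⟨q, Z.submatrix Sum.inl id, T, hq, fun x hx h1 h2 F w v hF => ?_⟩
  obtain ⟨Hr, HZ⟩ := H x hx
  simp only [hDx] at Hr HZ
  rw [hDγ, hr] at Hr HZ
  have hub : (Matrix.fromBlocks (B₀.map (eval x)) (B₁.map (eval x)) T 0).rank ≤ r + d :=
    h2 ▸ (rank_fromBlocks_eq _ _ T (hK x h1 h2)).1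
  obtain ⟨hinj, hsol⟩ := (rank_fromBlocks_eq _ _ T (hK x h1 h2)).2.2
    (by rw [h2]; exact le_antisymm hub Hr)
  have key : ∀ c, T.mulVec ((eval x q)⁻¹ •
        ((Z.submatrix Sum.inl id).map (eval x)).mulVec (Sum.elim F c)) = c ∧
      ∃ v', (B₀.map (eval x)).mulVec
        ((eval x q)⁻¹ • ((Z.submatrix Sum.inl id).map (eval x)).mulVec (Sum.elim F c)) +
        (B₁.map (eval x)).mulVec v' = F := by
    intro c
    obtain ⟨w', v', h3, h4⟩ := hsol w v c
    have h5 := HZ (le_antisymm hub Hr) (Sum.elim w' v')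
    set u := (eval x q)⁻¹ • (Z.map (eval x)).mulVec
      ((Matrix.fromBlocks (B₀.map (eval x)) (B₁.map (eval x)) T 0).mulVec (Sum.elim w' v')) with hu
    simp only [Matrix.fromBlocks_mulVec, Sum.elim_comp_inl, Sum.elim_comp_inr, h3, h4, hF,
      Matrix.zero_mulVec, add_zero, Sum.elim_eq_iff] at h5 hu
    have hu' : u ∘ Sum.inl =
        (eval x q)⁻¹ • ((Z.submatrix Sum.inl id).map (eval x)).mulVec (Sum.elim F c) := by
      rw [hu]; rfl
    rw [← hu']
    exact ⟨h5.2, _, h5.1⟩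
  refine ⟨key, ?_⟩
  obtain ⟨h3, v', h4⟩ := key (T.mulVec w)
  rw [← sub_eq_zero]
  apply hinj
  · refine ⟨v - v', ?_⟩
    rw [Matrix.mulVecLin_apply, Matrix.mulVecLin_apply, Matrix.mulVec_sub, Matrix.mulVec_sub]
    rw [sub_eq_sub_iff_add_eq_add, h4, add_comm, hF]
  · rw [Matrix.mulVec_sub, h3, sub_self]

end LinearAlgebra

/-! ### Zariski topology and regular functions -/

section Zariski

open MvPolynomial

variable {k : Type*} [Field k] {σ τ : Type*}

/-- A set is Zariski open if and only if it contains a principal open neighbourhood of each of its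
points. -/
theorem isZariskiOpen_iff {U : Set (σ → k)} :
    IsZariskiOpen U ↔ ∀ x ∈ U, ∃ q, eval x q ≠ 0 ∧ ∀ y, eval y q ≠ 0 → y ∈ U := by
  constructor
  · rintro ⟨S, rfl⟩ x ⟨q, hq, hx⟩
    exact ⟨q, hx, fun y hy => ⟨q, hq, hy⟩⟩
  · intro h
    choose! q hq hqU using h
    refine ⟨q '' U, Set.ext fun x => ⟨fun hx => ⟨_, ⟨x, hx, rfl⟩, hq x hx⟩, ?_⟩⟩
    rintro ⟨_, ⟨y, hy, rfl⟩, hx⟩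
    exact hqU y hy x hx

theorem isZariskiOpen_eval_ne_zero (q : MvPolynomial σ k) : IsZariskiOpen {x | eval x q ≠ 0} :=
  isZariskiOpen_iff.2 fun _ hx => ⟨q, hx, fun _ h => h⟩

theorem IsZariskiOpen.inter {U V : Set (σ → k)} (hU : IsZariskiOpen U) (hV : IsZariskiOpen V) :
    IsZariskiOpen (U ∩ V) := by
  rw [isZariskiOpen_iff] at *
  rintro x ⟨hxU, hxV⟩
  obtain ⟨p, hp, hpU⟩ := hU x hxU
  obtain ⟨q, hq, hqV⟩ := hV x hxV
  refine ⟨p * q, by simp [hp, hq], fun y hy => ?_⟩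
  rw [map_mul] at hy
  exact ⟨hpU y (left_ne_zero_of_mul hy), hqV y (right_ne_zero_of_mul hy)⟩

theorem IsZariskiOpen.setOf_forall_lt {U : ℕ → Set (σ → k)} (hU : ∀ i, IsZariskiOpen (U i))
    (n : ℕ) : IsZariskiOpen {x | ∀ i < n, x ∈ U i} := by
  induction n with
  | zero => simpa using isZariskiOpen_iff.2 fun x _ => ⟨1, by simp, by simp⟩
  | succ n ih =>
    convert ih.inter (hU n) using 1
    ext x
    simp only [Set.mem_ofPred_eq, Set.mem_inter_iff, Nat.forall_lt_succ_right]

/-- Lower semicontinuity of the rank. -/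
theorem isZariskiOpen_le_rank {p ι : Type*} [Fintype p] [Fintype ι] [DecidableEq p]
    [DecidableEq ι] (D : Matrix p ι (MvPolynomial σ k)) (r : ℕ) :
    IsZariskiOpen {x | r ≤ (D.map (eval x)).rank} := by
  rw [isZariskiOpen_iff]
  intro x hx
  obtain ⟨q, _, hq, H⟩ := exists_generalizedInverse D x
  exact ⟨q, hq, fun y hy => hx.trans (H y hy).1⟩

/-- A polynomial function divided by a polynomial without zeros on `V` is regular on `V`. -/
theorem isRegularFunOn_of_eq_div {φ : (σ → k) → k} {V : Set (σ → k)} (p q : MvPolynomial σ k)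
    (hq : ∀ x ∈ V, eval x q ≠ 0) (h : ∀ x ∈ V, φ x = eval x p / eval x q) :
    IsRegularFunOn φ V :=
  fun x hx => ⟨p, q, hq x hx, fun y hy _ => h y hy⟩

end Zariski

/-! ### Multiplication by matrices of power series, in coefficients -/

section Toeplitz

open PowerSeries (X coeff)

variable {A B : Type*} [CommRing A] [CommRing B] {μ ν : Type*}

/-- The tuple of polynomials in `t`, as power series, of degree less than `q`, with given
coefficients. -/
noncomputable def coeffSeries {q : ℕ} (u : ν × Fin q → A) (j : ν) : PowerSeries A :=
  ∑ c : Fin q, PowerSeries.C (u (j, c)) * X ^ (c : ℕ)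

theorem coeff_coeffSeries {q : ℕ} (u : ν × Fin q → A) (j : ν) (a : ℕ) :
    coeff a (coeffSeries u j) = if h : a < q then u (j, ⟨a, h⟩) else 0 := by
  simp only [coeffSeries, map_sum, PowerSeries.coeff_C_mul, PowerSeries.coeff_X_pow]
  split_ifs with h
  · rw [Finset.sum_eq_single ⟨a, h⟩]
    · simp
    · intro c _ hc
      rw [if_neg (fun h' => hc (Fin.ext h'.symm)), mul_zero]
    · simp
  · refine Finset.sum_eq_zero fun c _ => ?_
    rw [if_neg (by have := c.2; omega), mul_zero]

theorem map_coeffSeries (φ : A →+* B) {q : ℕ} (u : ν × Fin q → A) (j : ν) :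
    PowerSeries.map φ (coeffSeries u j) = coeffSeries (fun p => φ (u p)) j := by
  simp [coeffSeries]

/-- The matrix, over the coefficient ring, of the map `u ↦ t^o J u` from tuples of polynomials in
`t` of degree less than `q` to tuples of power series modulo `t^s`. -/
noncomputable def toeplitz (J : Matrix μ ν (PowerSeries A)) (s q o : ℕ) : Matrix (μ × Fin s) (ν × Fin q) A :=
  Matrix.of fun i j => coeff i.2 (J i.1 j.1 * X ^ (o + j.2 : ℕ))

theorem toeplitz_mulVec [Fintype ν] (J : Matrix μ ν (PowerSeries A)) (s q o : ℕ)
    (u : ν × Fin q → A) (i : μ × Fin s) :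
    (toeplitz J s q o).mulVec u i = coeff i.2 (∑ j, J i.1 j * (X ^ o * coeffSeries u j)) := by
  simp only [Matrix.mulVec, dotProduct, toeplitz, Matrix.of_apply, Fintype.sum_prod_type,
    coeffSeries, Finset.mul_sum, map_sum]
  refine Finset.sum_congr rfl fun j _ => Finset.sum_congr rfl fun c _ => ?_
  rw [mul_comm, ← PowerSeries.coeff_C_mul, pow_add]
  congr 1
  ring

theorem toeplitz_map (φ : A →+* B) (J : Matrix μ ν (PowerSeries A)) (s q o : ℕ) :
    (toeplitz J s q o).map φ = toeplitz (J.map (PowerSeries.map φ)) s q o := by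
  ext i j
  simp only [toeplitz, Matrix.map_apply, Matrix.of_apply]
  rw [← PowerSeries.coeff_map, map_mul, map_pow, PowerSeries.map_X]

theorem coeff_mul_eq_of_coeff_eq {x y z : PowerSeries A} {a : ℕ}
    (h : ∀ c ≤ a, coeff c x = coeff c y) : coeff a (x * z) = coeff a (y * z) := by
  rw [PowerSeries.coeff_mul, PowerSeries.coeff_mul]
  refine Finset.sum_congr rfl fun p hp => ?_
  rw [h p.1 (by rw [Finset.HasAntidiagonal.mem_antidiagonal] at hp; omega)]

theorem toeplitz_congr {J J' : Matrix μ ν (PowerSeries A)} {s : ℕ}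
    (h : ∀ i j, ∀ a < s, coeff a (J i j) = coeff a (J' i j)) (q o : ℕ) :
    toeplitz J s q o = toeplitz J' s q o := by
  ext i j
  exact coeff_mul_eq_of_coeff_eq fun c hc => h _ _ c (hc.trans_lt i.2.2)

theorem toeplitz_mulVec_eq_zero_iff [Fintype ν] (J : Matrix μ ν (PowerSeries A)) (s q o : ℕ)
    (u : ν × Fin q → A) :
    (toeplitz J s q o).mulVec u = 0 ↔
      ∀ i, X ^ s ∣ X ^ o * ∑ j, J i j * coeffSeries u j := by
  simp only [funext_iff, toeplitz_mulVec, PowerSeries.X_pow_dvd_iff, Pi.zero_apply, Prod.forall]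
  have : ∀ i, X ^ o * ∑ j, J i j * coeffSeries u j = ∑ j, J i j * (X ^ o * coeffSeries u j) := by
    intro i
    rw [Finset.mul_sum]
    exact Finset.sum_congr rfl fun _ _ => by ring
  simp only [this]
  exact forall_congr' fun i => ⟨fun h a ha => h ⟨a, ha⟩, fun h a => h a a.2⟩

variable {k : Type*} [Field k]

theorem rank_eq_of_ker_eq {p p' ι : Type*} [Fintype ι] {M : Matrix p ι k} {M' : Matrix p' ι k}
    (h : ∀ u, M.mulVec u = 0 ↔ M'.mulVec u = 0) : M.rank = M'.rank := by
  have h1 := LinearMap.finrank_range_add_finrank_ker M.mulVecLin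
  have h2 := LinearMap.finrank_range_add_finrank_ker M'.mulVecLin
  have h3 : LinearMap.ker M.mulVecLin = LinearMap.ker M'.mulVecLin := by
    ext u; exact h u
  rw [h3] at h1
  exact Nat.add_right_cancel (h1.trans h2.symm)

/-- Multiplication by `t^o` identifies the map `u ↦ t^o J u` modulo `t^s` with `u ↦ J u` modulo
`t^(s - o)`. -/
theorem rank_toeplitz_shift [Fintype ν] (J : Matrix μ ν (PowerSeries k)) {s q o : ℕ}
    (h : o + q = s) : (toeplitz J s q o).rank = (toeplitz J q q 0).rank := by
  subst h
  refine rank_eq_of_ker_eq fun u => ?_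
  rw [toeplitz_mulVec_eq_zero_iff, toeplitz_mulVec_eq_zero_iff]
  refine forall_congr' fun i => ?_
  rw [pow_add, pow_zero, one_mul, mul_dvd_mul_iff_left (pow_ne_zero _ PowerSeries.X_ne_zero)]

/-- Splitting the unknown `u` into its terms of degree less than `q₀` and the others. -/
theorem rank_fromCols_toeplitz [Fintype ν] (J : Matrix μ ν (PowerSeries k)) {s q₀ q₁ : ℕ}
    (h : q₀ + q₁ = s) :
    (Matrix.fromCols (toeplitz J s q₀ 0) (toeplitz J s q₁ q₀)).rank = (toeplitz J s s 0).rank := by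
  subst h
  let ε : (ν × Fin q₀) ⊕ (ν × Fin q₁) ≃ ν × Fin (q₀ + q₁) :=
    (Equiv.prodSumDistrib ν _ _).symm.trans ((Equiv.refl ν).prodCongr finSumFinEquiv)
  have : Matrix.fromCols (toeplitz J (q₀ + q₁) q₀ 0) (toeplitz J (q₀ + q₁) q₁ q₀) =
      (toeplitz J (q₀ + q₁) (q₀ + q₁) 0).submatrix (Equiv.refl _) ε := by
    ext i (⟨j, c⟩ | ⟨j, c⟩) <;> simp [toeplitz, ε, Equiv.prodSumDistrib]
  rw [this, Matrix.rank_submatrix]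

end Toeplitz

/-! ### Taylor expansion -/

section Taylor

open MvPolynomial (aeval pderiv)
open PowerSeries (X coeff)

variable {k : Type*} [Field k] {ν : Type*} [Fintype ν] [DecidableEq ν]

/-- First order Taylor expansion of a polynomial. -/
theorem exists_aeval_add_eq {A : Type*} [CommRing A] [Algebra k A] (x u : ν → A) (c : A)
    (p : MvPolynomial ν k) :
    ∃ r, aeval (fun j => x j + c * u j) p =
      aeval x p + c * ∑ j, aeval x (pderiv j p) * u j + c ^ 2 * r := by
  induction p using MvPolynomial.induction_on with
  | C a => exact ⟨0, by simp⟩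
  | add p q hp hq =>
    obtain ⟨r, hr⟩ := hp
    obtain ⟨s, hs⟩ := hq
    refine ⟨r + s, ?_⟩
    simp only [map_add, hr, hs, add_mul, Finset.sum_add_distrib]
    ring
  | mul_X p i hp =>
    obtain ⟨r, hr⟩ := hp
    have h1 : ∑ j, aeval x (pderiv j (p * MvPolynomial.X i)) * u j =
        (∑ j, aeval x (pderiv j p) * u j) * x i + aeval x p * u i := by
      simp only [Derivation.leibniz, MvPolynomial.pderiv_X, smul_eq_mul, map_add, map_mul,
        MvPolynomial.aeval_X, add_mul, Finset.sum_add_distrib, Finset.sum_mul]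
      rw [add_comm]
      congr 1
      · exact Finset.sum_congr rfl fun j _ => by ring
      · rw [Finset.sum_eq_single i]
        · simp
        · intro j _ hj; simp [hj.symm]
        · simp
    refine ⟨(∑ j, aeval x (pderiv j p) * u j) * u i + r * x i + c * r * u i, ?_⟩
    rw [map_mul, map_mul, hr, MvPolynomial.aeval_X, MvPolynomial.aeval_X, h1]
    ring

theorem coeff_aeval_eq_of_coeff_eq {A : Type*} [CommRing A] [Algebra k A]
    {x y : ν → PowerSeries A} {s : ℕ}
    (h : ∀ j, ∀ a < s, coeff a (x j) = coeff a (y j)) (p : MvPolynomial ν k) :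
    ∀ a < s, coeff a (aeval x p) = coeff a (aeval y p) := by
  have hd : ∀ j, X ^ s ∣ x j - y j := fun j => by
    rw [PowerSeries.X_pow_dvd_iff]
    intro a ha; rw [map_sub, h j a ha, sub_self]
  choose u hu using hd
  obtain ⟨r, hr⟩ := exists_aeval_add_eq y u (X ^ s) p
  have hx : x = fun j => y j + X ^ s * u j := funext fun j => by rw [← hu]; ring
  have : X ^ s ∣ aeval x p - aeval y p := by
    rw [hx, hr]
    exact ⟨(∑ j, aeval y (pderiv j p) * u j) + X ^ s * r, by ring⟩
  rw [PowerSeries.X_pow_dvd_iff] at this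
  intro a ha
  exact sub_eq_zero.1 (by rw [← map_sub]; exact this a ha)

/-- Vanishing of `p` at `x + t^L u` modulo `t^M`, for `M ≤ 2 L`, is the vanishing of `p` at `x`
modulo `t^L` together with linear equations for the coefficients of `u`. -/
theorem X_pow_dvd_aeval_add_iff (x u : ν → PowerSeries k) {L s : ℕ} (hs : s ≤ L)
    (p : MvPolynomial ν k) :
    X ^ (L + s) ∣ aeval (fun j => x j + X ^ L * u j) p ↔
      X ^ L ∣ aeval x p ∧ ∀ a < s,
        coeff a (∑ j, aeval x (pderiv j p) * u j) + coeff (L + a) (aeval x p) = 0 := by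
  obtain ⟨r, hr⟩ := exists_aeval_add_eq x u (X ^ L) p
  set Q := ∑ j, aeval x (pderiv j p) * u j
  have h1 : X ^ (L + s) ∣ (X ^ L) ^ 2 * r := by
    refine Dvd.dvd.mul_right ?_ _
    rw [← pow_mul]
    exact pow_dvd_pow _ (by omega)
  rw [hr, dvd_add_left h1]
  have h2 : ∀ a, coeff (L + a) (X ^ L * Q) = coeff a Q := fun a => by
    rw [add_comm, PowerSeries.coeff_X_pow_mul]
  constructor
  · intro h
    refine ⟨(dvd_add_left (dvd_mul_right (X ^ L) Q)).1 ((pow_dvd_pow _ (by omega)).trans h), ?_⟩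
    intro a ha
    rw [← h2, add_comm, ← map_add]
    exact PowerSeries.X_pow_dvd_iff.1 h _ (by omega)
  · rintro ⟨h, h'⟩
    rw [PowerSeries.X_pow_dvd_iff]
    intro a ha
    rcases lt_or_ge a L with haL | haL
    · exact PowerSeries.X_pow_dvd_iff.1 (dvd_add h (dvd_mul_right _ _)) _ haL
    · obtain ⟨c, rfl⟩ := Nat.exists_eq_add_of_le haL
      rw [map_add, h2, add_comm]
      exact h' c (by omega)

end Taylor

/-! ### Truncation of jets -/

section Truncation

variable {k : Type*} {N : ℕ}

/-- The coefficients of a jet in degrees greater than `l`. -/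
def jetTail {l n : ℕ} (_ : l ≤ n) (θ : Jet k N n) : Fin N × Fin (n - l) → k :=
  fun p => θ (p.1, ⟨l + 1 + p.2, by omega⟩)

/-- The jet with given truncation and given coefficients in degrees greater than `l`. -/
def jetGlue {l n : ℕ} (_ : l ≤ n) (η : Jet k N l) (w : Fin N × Fin (n - l) → k) : Jet k N n :=
  fun p => if h : (p.2 : ℕ) < l + 1 then η (p.1, ⟨p.2, h⟩) else w (p.1, ⟨p.2 - (l + 1), by omega⟩)

variable {l n : ℕ} (h : l ≤ n)

theorem trunc_jetGlue (η : Jet k N l) (w : Fin N × Fin (n - l) → k) :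
    Jet.trunc h (jetGlue h η w) = η := by
  ext ⟨i, c⟩
  exact dif_pos c.2

theorem jetTail_jetGlue (η : Jet k N l) (w : Fin N × Fin (n - l) → k) :
    jetTail h (jetGlue h η w) = w := by
  ext ⟨i, c⟩
  have : ¬ (l + 1 + (c : ℕ) < l + 1) := by omega
  simp [jetTail, jetGlue, this]

theorem jetGlue_trunc_jetTail (θ : Jet k N n) : jetGlue h (Jet.trunc h θ) (jetTail h θ) = θ := by
  ext ⟨i, c⟩
  simp only [jetTail, jetGlue, Jet.trunc]
  split_ifs with hc
  · rfl
  · congr 3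
    omega

end Truncation

/-! ### Jets as tuples of power series -/

section Jets

open MvPolynomial (aeval pderiv eval)
open PowerSeries (X coeff)

variable {k : Type*} [Field k] {N m : ℕ}

/-- The Jacobian matrix of `f` at a tuple of power series. -/
noncomputable def jacobian {A : Type*} [CommRing A] [Algebra k A]
    (f : Fin m → MvPolynomial (Fin N) k) (x : Fin N → PowerSeries A) :
    Matrix (Fin m) (Fin N) (PowerSeries A) :=
  Matrix.of fun i j => aeval x (pderiv j (f i))

theorem aeval_toTuple {n : ℕ} (θ : Jet k N n) (p : MvPolynomial (Fin N) k) :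
    aeval θ.toTuple p = Ideal.Quotient.mk _ (aeval (coeffSeries θ) p) := by
  change _ = Ideal.Quotient.mkₐ k _ _
  rw [MvPolynomial.comp_aeval_apply]
  rfl

theorem aeval_toTuple_eq_zero_iff {n : ℕ} (θ : Jet k N n) (p : MvPolynomial (Fin N) k) :
    aeval θ.toTuple p = 0 ↔ X ^ (n + 1) ∣ aeval (coeffSeries θ) p := by
  rw [aeval_toTuple, Ideal.Quotient.eq_zero_iff_mem, Ideal.mem_span_singleton]

theorem mem_jetsOn_span_range {n : ℕ} {f : Fin m → MvPolynomial (Fin N) k} {θ : Jet k N n} :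
    θ ∈ jetsOn n (Ideal.span (Set.range f)) ↔
      ∀ i, X ^ (n + 1) ∣ aeval (coeffSeries θ) (f i) := by
  simp only [← aeval_toTuple_eq_zero_iff]
  constructor
  · exact fun h i => h _ (Ideal.subset_span ⟨i, rfl⟩)
  · intro h p hp
    have : Ideal.span (Set.range f) ≤ RingHom.ker (aeval θ.toTuple) := by
      rw [Ideal.span_le]
      rintro _ ⟨i, rfl⟩
      exact h i
    exact this hp

variable {l n : ℕ} (h : l ≤ n)

theorem coeffSeries_eq_trunc_add (θ : Jet k N n) (j : Fin N) :
    coeffSeries θ j =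
      coeffSeries (Jet.trunc h θ) j + X ^ (l + 1) * coeffSeries (jetTail h θ) j := by
  ext a
  rw [map_add, PowerSeries.coeff_X_pow_mul']
  simp only [coeff_coeffSeries]
  split_ifs <;> first | omega | simp [Jet.trunc, jetTail]
  congr 3; omega

theorem coeff_coeffSeries_trunc (θ : Jet k N n) (j : Fin N) {a : ℕ} (ha : a < l + 1) :
    coeff a (coeffSeries θ j) = coeff a (coeffSeries (Jet.trunc h θ) j) := by
  rw [coeffSeries_eq_trunc_add h, map_add, PowerSeries.coeff_X_pow_mul', if_neg (by omega),
    add_zero]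

theorem toeplitz_jacobian_trunc (f : Fin m → MvPolynomial (Fin N) k) (θ : Jet k N n) {s : ℕ}
    (hs : s ≤ l + 1) (q o : ℕ) :
    toeplitz (jacobian f (coeffSeries (Jet.trunc h θ))) s q o =
      toeplitz (jacobian f (coeffSeries θ)) s q o :=
  toeplitz_congr (fun i j a ha => coeff_aeval_eq_of_coeff_eq
    (fun j c hc => (coeff_coeffSeries_trunc h θ j (by omega)).symm) _ a ha) q o

/-- The obstruction to lifting the `l`-jet `η` of the scheme `f = 0`: the coefficients of `f(η)` in
the degrees `l + 1, …, l + s`. -/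
noncomputable def obstruction {A : Type*} [CommRing A] [Algebra k A]
    (f : Fin m → MvPolynomial (Fin N) k) (s : ℕ) (η : Fin N × Fin (l + 1) → A) :
    Fin m × Fin s → A :=
  fun i => coeff (l + 1 + i.2) (aeval (coeffSeries η) (f i.1))

/-- An `n`-jet lies on the scheme `f = 0` if and only if its `l`-jet does and its coefficients in
the degrees greater than `l` solve a linear system, whose matrix is that of the Jacobian matrix. The
unknowns are split into the degrees up to `l'` and the degrees greater than `l'`. -/
theorem mem_jetsOn_iff_linear {l l' n : ℕ} (hl : l ≤ l') (hl' : l' ≤ n) (hn : n ≤ 2 * l + 1)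
    (f : Fin m → MvPolynomial (Fin N) k) (θ : Jet k N n) :
    θ ∈ jetsOn n (Ideal.span (Set.range f)) ↔
      Jet.trunc (hl.trans hl') θ ∈ jetsOn l (Ideal.span (Set.range f)) ∧
      (toeplitz (jacobian f (coeffSeries θ)) (n - l) (l' - l) 0).mulVec
          (jetTail hl (Jet.trunc hl' θ)) +
        (toeplitz (jacobian f (coeffSeries θ)) (n - l) (n - l') (l' - l)).mulVec (jetTail hl' θ) =
        -obstruction f (n - l) (Jet.trunc (hl.trans hl') θ) := by
  rw [← toeplitz_jacobian_trunc (hl.trans hl') f θ (by omega),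
    ← toeplitz_jacobian_trunc (hl.trans hl') f θ (by omega)]
  set η := Jet.trunc (hl.trans hl') θ with hη
  set w := jetTail hl (Jet.trunc hl' θ)
  set v := jetTail hl' θ
  have hx : coeffSeries θ = fun j => coeffSeries η j +
      X ^ (l + 1) * (coeffSeries w j + X ^ (l' - l) * coeffSeries v j) := by
    funext j
    rw [coeffSeries_eq_trunc_add hl' θ, coeffSeries_eq_trunc_add hl (Jet.trunc hl' θ), mul_add,
      ← mul_assoc, ← pow_add, show l + 1 + (l' - l) = l' + 1 by omega, add_assoc]
    rfl
  rw [mem_jetsOn_span_range, mem_jetsOn_span_range, hx]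
  have hn' : n + 1 = l + 1 + (n - l) := by omega
  simp only [hn', X_pow_dvd_aeval_add_iff _ _ (show n - l ≤ l + 1 by omega), forall_and]
  refine and_congr_right fun _ => ?_
  rw [← add_eq_zero_iff_eq_neg, funext_iff, Prod.forall]
  refine forall_congr' fun i => ⟨fun H a => ?_, fun H a ha => ?_⟩
  · refine Eq.trans ?_ (H a a.2)
    simp only [Pi.add_apply, toeplitz_mulVec, obstruction, jacobian, Matrix.of_apply, pow_zero,
      one_mul, mul_add, Finset.sum_add_distrib, map_add]
  · have := H ⟨a, ha⟩
    simp only [Pi.add_apply, toeplitz_mulVec, obstruction, jacobian, Matrix.of_apply, pow_zero,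
      one_mul, Pi.zero_apply] at this
    simpa only [mul_add, Finset.sum_add_distrib, map_add] using this

theorem map_aeval_coeffSeries {A B : Type*} [CommRing A] [CommRing B] [Algebra k A] [Algebra k B]
    (φ : A →ₐ[k] B) {q : ℕ} (u : Fin N × Fin q → A) (p : MvPolynomial (Fin N) k) :
    PowerSeries.map (φ : A →+* B) (aeval (coeffSeries u) p) =
      aeval (coeffSeries fun i => φ (u i)) p := by
  change PowerSeries.mapAlgHom φ _ = _
  rw [MvPolynomial.comp_aeval_apply]
  congr 2
  funext j
  exact map_coeffSeries (φ : A →+* B) u j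

/-- The matrix `toeplitz` of the Jacobian matrix at the universal jet. -/
noncomputable def univToeplitz (f : Fin m → MvPolynomial (Fin N) k) (l s q o : ℕ) :
    Matrix (Fin m × Fin s) (Fin N × Fin q) (MvPolynomial (Fin N × Fin (l + 1)) k) :=
  toeplitz (jacobian f (coeffSeries MvPolynomial.X)) s q o

theorem univToeplitz_map_eval (f : Fin m → MvPolynomial (Fin N) k) (s q o : ℕ) (η : Jet k N l) :
    (univToeplitz f l s q o).map (eval η) = toeplitz (jacobian f (coeffSeries η)) s q o := by
  rw [univToeplitz, toeplitz_map]
  congr 1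
  refine Matrix.ext fun i j => ?_
  have := map_aeval_coeffSeries (MvPolynomial.aeval η)
    (MvPolynomial.X : _ → MvPolynomial (Fin N × Fin (l + 1)) k) (pderiv j (f i))
  simp only [MvPolynomial.aeval_X] at this
  exact this

theorem eval_coeff_aeval_univ (p : MvPolynomial (Fin N) k) (a : ℕ) (η : Jet k N l) :
    eval η (coeff a (aeval (coeffSeries
      (MvPolynomial.X : _ → MvPolynomial (Fin N × Fin (l + 1)) k)) p)) =
      coeff a (aeval (coeffSeries η) p) := by
  have := map_aeval_coeffSeries (MvPolynomial.aeval η)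
    (MvPolynomial.X : _ → MvPolynomial (Fin N × Fin (l + 1)) k) p
  simp only [MvPolynomial.aeval_X] at this
  rw [← this, PowerSeries.coeff_map]
  rfl

end Jets

/-! ### Homomorphisms to truncated power series rings -/

section HomModules

open PowerSeries (X coeff)

variable {k : Type*} [Field k] {N : ℕ} {μ : Type*}

theorem mk_coeffSeries_bijective (s : ℕ) :
    Function.Bijective (fun (u : Fin N × Fin s → k) (j : Fin N) =>
      (Ideal.Quotient.mk _ (coeffSeries u j) : TruncRing k s)) := by
  constructor
  · intro u v huv
    ext ⟨j, c⟩
    have h := Ideal.Quotient.eq.1 (congrFun huv j)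
    rw [Ideal.mem_span_singleton, PowerSeries.X_pow_dvd_iff] at h
    have := h c c.2
    simpa [coeff_coeffSeries, sub_eq_zero] using this
  · intro y
    choose x hx using fun j => Ideal.Quotient.mk_surjective (y j)
    refine ⟨fun p => coeff p.2 (x p.1), funext fun j => ?_⟩
    rw [← hx j]
    refine Ideal.Quotient.eq.2 ?_
    rw [Ideal.mem_span_singleton, PowerSeries.X_pow_dvd_iff]
    intro a ha
    simp [coeff_coeffSeries, ha]

/-- A homomorphism from `M` to `k⟦t⟧/(t^s)` is given by the images `u j` of the generators of `M`,
subject to the relations between these. The hypothesis says that these relations amount to `J u = 0`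
modulo `t^s`; it holds if `M` is the cokernel of `Jᵀ`. -/
theorem finrank_hom_add_rank {M : Type*} [AddCommGroup M] [Module (PowerSeries k) M]
    (π : (Fin N → PowerSeries k) →ₗ[PowerSeries k] M) (hπ : Function.Surjective π) (s : ℕ)
    (J : Matrix μ (Fin N) (PowerSeries k))
    (hJ : ∀ u : Fin N → TruncRing k s, (∀ r ∈ LinearMap.ker π, ∑ j, r j • u j = 0) ↔
      ∀ i, ∑ j, J i j • u j = 0) :
    Module.finrank k (M →ₗ[PowerSeries k] TruncRing k s) + (toeplitz J s s 0).rank = N * s := by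
  let ι : (Fin N × Fin s → k) →ₗ[k] (Fin N → TruncRing k s) :=
    { toFun := fun u j => Ideal.Quotient.mk _ (coeffSeries u j)
      map_add' := fun u v => by
        ext j
        simp [coeffSeries, add_mul, Finset.sum_add_distrib]
      map_smul' := fun a u => by
        ext j
        have : coeffSeries (a • u) j = a • coeffSeries u j := by
          simp [coeffSeries, Finset.smul_sum, PowerSeries.smul_eq_C_mul, mul_assoc]
        rw [this]
        exact map_smul (Ideal.Quotient.mkₐ k _) a _ }
  let ε := LinearEquiv.ofBijective ι (mk_coeffSeries_bijective s)
  let Θ : (M →ₗ[PowerSeries k] TruncRing k s) →ₗ[k] (Fin N → TruncRing k s) :=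
    { toFun := fun φ j => φ (π (Pi.single j 1))
      map_add' := fun _ _ => rfl
      map_smul' := fun _ _ => rfl }
  have hΘ : ∀ (φ : M →ₗ[PowerSeries k] TruncRing k s) r, φ (π r) = ∑ j, r j • Θ φ j := by
    intro φ r
    conv_lhs => rw [pi_eq_sum_univ' r]
    simp only [map_sum, map_smul]
    rfl
  have hΘi : Function.Injective Θ := by
    intro φ ψ h
    ext x
    obtain ⟨r, rfl⟩ := hπ x
    rw [hΘ, hΘ, h]
  have hrange : LinearMap.range Θ = (LinearMap.ker (toeplitz J s s 0).mulVecLin).map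
      ε.toLinearMap := by
    ext y
    obtain ⟨u, rfl⟩ := ε.surjective y
    have h1 : (ε u ∈ (LinearMap.ker (toeplitz J s s 0).mulVecLin).map ε.toLinearMap) ↔
        (toeplitz J s s 0).mulVec u = 0 := by
      rw [Submodule.mem_map_equiv]
      simp
    have h2 : (toeplitz J s s 0).mulVec u = 0 ↔ ∀ i, ∑ j, J i j • ε u j = 0 := by
      rw [toeplitz_mulVec_eq_zero_iff]
      refine forall_congr' fun i => ?_
      rw [pow_zero, one_mul, ← Ideal.mem_span_singleton, ← Ideal.Quotient.eq_zero_iff_mem, map_sum]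
      rfl
    rw [h1, h2, ← hJ]
    constructor
    · rintro ⟨φ, hφ⟩ r hr
      rw [← hφ, ← hΘ, LinearMap.mem_ker.1 hr, map_zero]
    · intro h
      let ψ : (Fin N → PowerSeries k) →ₗ[PowerSeries k] TruncRing k s :=
        Fintype.linearCombination (PowerSeries k) (ε u)
      have hψ : LinearMap.ker π ≤ LinearMap.ker ψ := fun r hr => by
        rw [LinearMap.mem_ker, Fintype.linearCombination_apply]
        exact h r hr
      refine ⟨(LinearMap.ker π).liftQ ψ hψ ∘ₗ (π.quotKerEquivOfSurjective hπ).symm.toLinearMap, ?_⟩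
      ext j
      have h3 : (π.quotKerEquivOfSurjective hπ).symm (π (Pi.single j 1)) =
          (LinearMap.ker π).mkQ (Pi.single j 1) := by
        rw [LinearEquiv.symm_apply_eq]; rfl
      change (LinearMap.ker π).liftQ ψ hψ ((π.quotKerEquivOfSurjective hπ).symm _) = _
      rw [h3, Submodule.mkQ_apply, Submodule.liftQ_apply, Fintype.linearCombination_apply_single,
        one_smul]
  have h1 := LinearMap.finrank_range_of_inj hΘi
  rw [hrange, LinearEquiv.finrank_map_eq] at h1
  have h2 := LinearMap.finrank_range_add_finrank_ker (toeplitz J s s 0).mulVecLin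
  rw [h1, Module.finrank_fintype_fun_eq_card, Fintype.card_prod, Fintype.card_fin,
    Fintype.card_fin] at h2
  rw [add_comm]
  exact h2

theorem rank_toeplitz_diagonal (E : Fin N → ℕ) (s : ℕ) :
    (toeplitz (Matrix.diagonal fun i => (X : PowerSeries k) ^ E i) s s 0).rank =
      ∑ i, (s - E i) := by
  classical
  have h : (toeplitz (Matrix.diagonal fun i => (X : PowerSeries k) ^ E i) s s 0).rank =
      (Matrix.diagonal fun p : Fin N × Fin s => if (p.2 : ℕ) + E p.1 < s then (1 : k) else 0).rank
      := by
    refine rank_eq_of_ker_eq fun u => ?_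
    rw [toeplitz_mulVec_eq_zero_iff, funext_iff, Prod.forall]
    refine forall_congr' fun i => ?_
    have h1 : ∑ j, Matrix.diagonal (fun i => (X : PowerSeries k) ^ E i) i j * coeffSeries u j =
        X ^ E i * coeffSeries u i := by
      rw [Finset.sum_eq_single i]
      · simp
      · intro j _ hj; simp [Matrix.diagonal_apply_ne' _ hj]
      · simp
    rw [h1, pow_zero, one_mul, PowerSeries.X_pow_dvd_iff]
    simp only [Matrix.mulVec_diagonal, Pi.zero_apply, ite_mul, one_mul, zero_mul,
      ite_eq_right_iff, PowerSeries.coeff_X_pow_mul', coeff_coeffSeries]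
    constructor
    · intro H c hc
      have := H _ hc (by omega)
      simpa using this
    · intro H a ha hE
      rw [dif_pos (by omega)]
      exact H ⟨a - E i, by omega⟩ (by simp only; omega)
  rw [h, Matrix.rank_diagonal, Fintype.card_subtype, Finset.card_filter, Fintype.sum_prod_type]
  refine Finset.sum_congr rfl fun i _ => ?_
  rw [← Finset.card_filter]
  have : (Finset.univ.filter fun c : Fin s =>
      (if (c : ℕ) + E i < s then (1 : k) else 0) ≠ 0) =
      Finset.univ.filter fun c : Fin s => (c : ℕ) < s - E i := by
    ext c
    simp; omega
  rw [this, Fin.card_filter_val_lt]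
  omega

end HomModules

/-! ### Invariants of a jet -/

section Invariants

open MvPolynomial (aeval pderiv)
open PowerSeries (X coeff)

variable {k : Type*} [Field k] {N m : ℕ}

/-- Reduction of tuples of power series modulo powers of `t`. -/
noncomputable def reduceTuple (k : Type*) [Field k] {N : ℕ} (E : Fin N → ℕ) :
    (Fin N → PowerSeries k) →ₗ[PowerSeries k] ((i : Fin N) → TruncRing k (E i)) :=
  LinearMap.pi fun i => Submodule.mkQ _ ∘ₗ LinearMap.proj i

theorem reduceTuple_surjective (E : Fin N → ℕ) : Function.Surjective (reduceTuple k E) := by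
  intro y
  choose x hx using fun j => Ideal.Quotient.mk_surjective (y j)
  exact ⟨x, funext hx⟩

theorem mem_ker_reduceTuple {E : Fin N → ℕ} {r : Fin N → PowerSeries k} :
    r ∈ LinearMap.ker (reduceTuple k E) ↔ ∀ i, X ^ E i ∣ r i := by
  rw [LinearMap.mem_ker, funext_iff]
  refine forall_congr' fun i => ?_
  rw [← Ideal.mem_span_singleton, ← Ideal.Quotient.eq_zero_iff_mem]
  rfl

theorem X_pow_smul_truncRing {s t : ℕ} (h : s ≤ t) {r : PowerSeries k} (hr : X ^ t ∣ r)
    (u : TruncRing k s) : r • u = 0 := by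
  obtain ⟨x, rfl⟩ := Ideal.Quotient.mk_surjective u
  change Ideal.Quotient.mk _ (r * x) = 0
  rw [Ideal.Quotient.eq_zero_iff_mem, Ideal.mem_span_singleton]
  exact ((pow_dvd_pow X h).trans hr).mul_right x

theorem rowModule_eq_map {n : ℕ} (f : Fin m → MvPolynomial (Fin N) k) (θ : Jet k N n) :
    rowModule f θ = (Submodule.span (PowerSeries k)
      (Set.range (jacobian f (coeffSeries θ)).row)).map (reduceTuple k fun _ => n + 1) := by
  rw [rowModule, Submodule.map_span, ← Set.range_comp]
  congr 2
  funext i j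
  exact aeval_toTuple θ _

/-- The invariants of a jet determine the ranks of its Jacobian matrix modulo powers of `t`. -/
theorem rank_toeplitz_of_isInvariantSeq {n : ℕ} {f : Fin m → MvPolynomial (Fin N) k}
    {θ : Jet k N n} {E : Fin N → ℕ} (hE : IsInvariantSeq f θ E) {s : ℕ} (hs : s ≤ n + 1) :
    (toeplitz (jacobian f (coeffSeries θ)) s s 0).rank = ∑ i, (s - E i) := by
  obtain ⟨-, -, ⟨φ⟩⟩ := hE
  set π₀ := (rowModule f θ).mkQ ∘ₗ reduceTuple k fun _ => n + 1 with hπ₀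
  have hker : LinearMap.ker (φ.toLinearMap ∘ₗ π₀) = LinearMap.ker π₀ :=
    LinearMap.ker_comp_of_ker_eq_bot _ φ.ker
  have h1 := finrank_hom_add_rank (φ.toLinearMap ∘ₗ π₀)
    (φ.surjective.comp ((Submodule.mkQ_surjective _).comp (reduceTuple_surjective _))) s
    (jacobian f (coeffSeries θ)) (by
      intro u
      rw [hker]
      constructor
      · intro H i
        refine H _ ?_
        rw [LinearMap.mem_ker, hπ₀, LinearMap.comp_apply, Submodule.mkQ_apply,
          Submodule.Quotient.mk_eq_zero, rowModule_eq_map]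
        exact Submodule.mem_map_of_mem (Submodule.subset_span ⟨i, rfl⟩)
      · intro H r hr
        rw [LinearMap.mem_ker, hπ₀, LinearMap.comp_apply, Submodule.mkQ_apply,
          Submodule.Quotient.mk_eq_zero, rowModule_eq_map] at hr
        obtain ⟨r', hr', hrr'⟩ := hr
        have h2 : r - r' ∈ LinearMap.ker (reduceTuple k fun _ : Fin N => n + 1) := by
          rw [LinearMap.mem_ker, map_sub, hrr', sub_self]
        rw [mem_ker_reduceTuple] at h2
        have h3 : ∑ j, r' j • u j = 0 := by
          have : Submodule.span (PowerSeries k) (Set.range (jacobian f (coeffSeries θ)).row) ≤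
              LinearMap.ker (Fintype.linearCombination (PowerSeries k) u) := by
            rw [Submodule.span_le]
            rintro _ ⟨i, rfl⟩
            exact H i
          exact this hr'
        calc ∑ j, r j • u j = ∑ j, ((r - r') j • u j + r' j • u j) :=
              Finset.sum_congr rfl fun j _ => by rw [← add_smul]; simp
          _ = 0 := by
            rw [Finset.sum_add_distrib, h3, add_zero]
            exact Finset.sum_eq_zero fun j _ => X_pow_smul_truncRing hs (h2 j) _)
  have h2 := finrank_hom_add_rank (reduceTuple k E) (reduceTuple_surjective E) s
    (Matrix.diagonal fun i => (X : PowerSeries k) ^ E i) (by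
      intro u
      have h3 : ∀ i, ∑ j, Matrix.diagonal (fun i => (X : PowerSeries k) ^ E i) i j • u j =
          (X : PowerSeries k) ^ E i • u i := by
        intro i
        rw [Finset.sum_eq_single i]
        · simp
        · intro j _ hj; simp [Matrix.diagonal_apply_ne' _ hj]
        · simp
      simp only [h3]
      constructor
      · intro H i
        rw [← h3]
        refine H _ (mem_ker_reduceTuple.2 fun j => ?_)
        rcases eq_or_ne i j with rfl | hij
        · simp
        · simp [Matrix.diagonal_apply_ne _ hij]
      · intro H r hr
        refine Finset.sum_eq_zero fun j _ => ?_
        obtain ⟨c, hc⟩ := mem_ker_reduceTuple.1 hr j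
        rw [hc, mul_comm, mul_smul, H, smul_zero])
  rw [rank_toeplitz_diagonal] at h2
  omega

/-- The invariants of a jet exist, by the structure theorem for finitely generated modules over the
principal ideal domain `k⟦t⟧`. -/
theorem exists_isInvariantSeq {n : ℕ} (f : Fin m → MvPolynomial (Fin N) k) (θ : Jet k N n) :
    ∃ E, IsInvariantSeq f θ E := by
  set π₀ := (rowModule f θ).mkQ ∘ₗ reduceTuple k fun _ => n + 1 with hπ₀
  have hsurj : Function.Surjective π₀ :=
    (Submodule.mkQ_surjective _).comp (reduceTuple_surjective _)
  have hX : ∀ r : Fin N → PowerSeries k, (X : PowerSeries k) ^ (n + 1) • r ∈ LinearMap.ker π₀ := by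
    intro r
    rw [LinearMap.mem_ker, hπ₀, LinearMap.comp_apply, LinearMap.mem_ker.1
      (mem_ker_reduceTuple.2 fun i => ?_), map_zero]
    exact dvd_mul_right _ _
  have hrank : Module.finrank (PowerSeries k) (LinearMap.ker π₀) =
      Module.finrank (PowerSeries k) (Fin N → PowerSeries k) := by
    apply le_antisymm (Submodule.finrank_le _)
    refine LinearMap.finrank_le_finrank_of_injective
      (f := ((X : PowerSeries k) ^ (n + 1) • LinearMap.id).codRestrict _ hX) ?_
    intro x y hxy
    have h1 : (X : PowerSeries k) ^ (n + 1) • x = (X : PowerSeries k) ^ (n + 1) • y :=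
      congrArg Subtype.val hxy
    exact smul_right_injective _ (pow_ne_zero (n + 1) PowerSeries.X_ne_zero) h1
  let b := Pi.basisFun (PowerSeries k) (Fin N)
  have ψ := (π₀.quotKerEquivOfSurjective hsurj).symm.trans
    (Submodule.quotientEquivPiSpan (LinearMap.ker π₀) b hrank)
  choose E₀ hE₀ using fun i => IsDiscreteValuationRing.associated_pow_irreducible
    (Submodule.smithNormalFormCoeffs_ne_zero b hrank i) (PowerSeries.X_irreducible (R := k))
  have ψ' : ((Fin N → TruncRing k (n + 1)) ⧸ rowModule f θ) ≃ₗ[PowerSeries k]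
      ((i : Fin N) → TruncRing k (E₀ i)) :=
    ψ.trans (LinearEquiv.piCongrRight fun i => Submodule.quotEquivOfEq _ _
      (Ideal.span_singleton_eq_span_singleton.2 (hE₀ i)))
  have hle : ∀ i, E₀ i ≤ n + 1 := by
    intro i
    obtain ⟨x, hx⟩ := ψ'.surjective (Pi.single i 1)
    obtain ⟨r, rfl⟩ := hsurj x
    have h1 : (X : PowerSeries k) ^ (n + 1) • (1 : TruncRing k (E₀ i)) = 0 := by
      have := congrFun (congrArg (fun y => (X : PowerSeries k) ^ (n + 1) • y) hx) i
      simp only [← map_smul, LinearMap.mem_ker.1 (hX r), map_zero] at this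
      simpa using this.symm
    have h2 : Ideal.Quotient.mk (Ideal.span {(X : PowerSeries k) ^ E₀ i}) (X ^ (n + 1) * 1) = 0 :=
      h1
    rw [mul_one, Ideal.Quotient.eq_zero_iff_mem, Ideal.mem_span_singleton,
      pow_dvd_pow_iff PowerSeries.X_ne_zero PowerSeries.X_irreducible.not_isUnit] at h2
    exact h2
  let ρ : ((i : Fin N) → TruncRing k ((E₀ ∘ Tuple.sort E₀) i)) ≃ₗ[PowerSeries k]
      ((i : Fin N) → TruncRing k (E₀ i)) :=
    LinearEquiv.piCongrLeft (PowerSeries k) (fun i => TruncRing k (E₀ i)) (Tuple.sort E₀)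
  exact ⟨E₀ ∘ Tuple.sort E₀, Tuple.monotone_sort E₀, fun i => hle _, ⟨ψ'.trans ρ.symm⟩⟩

end Invariants

/-! ### Nondecreasing sequences -/

section Counting

theorem le_iff_lt_card {N : ℕ} {E : Fin N → ℕ} (hE : Monotone E) (i : Fin N) (s : ℕ) :
    E i ≤ s ↔ (i : ℕ) < (Finset.univ.filter fun j => E j ≤ s).card := by
  constructor
  · intro h
    have : Finset.Iic i ⊆ Finset.univ.filter fun j => E j ≤ s := fun j hj => by
      simpa using (hE (Finset.mem_Iic.1 hj)).trans h
    have := Finset.card_le_card this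
    rw [Fin.card_Iic] at this
    omega
  · intro h
    by_contra! h'
    have : (Finset.univ.filter fun j => E j ≤ s) ⊆ Finset.Iio i := fun j hj => by
      rw [Finset.mem_Iio]
      by_contra! hij
      have := hE hij
      have := (Finset.mem_filter.1 hj).2
      omega
    have := Finset.card_le_card this
    rw [Fin.card_Iio] at this
    omega

theorem sum_succ_sub_eq {ι : Type*} [Fintype ι] (E : ι → ℕ) (s : ℕ) :
    ∑ i, (s + 1 - E i) = ∑ i, (s - E i) + (Finset.univ.filter fun j => E j ≤ s).card := by
  rw [Finset.card_filter, ← Finset.sum_add_distrib]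
  refine Finset.sum_congr rfl fun i _ => ?_
  split_ifs <;> omega

/-- A nondecreasing sequence `E` truncated at `g` is determined by the sums `∑ i, (s - E i)`,
`s ≤ g`, with truncated subtraction. -/
theorem forall_sum_sub_eq_iff {N b g : ℕ} (hbN : b ≤ N) {E : Fin N → ℕ} (hE : Monotone E)
    {e : Fin b → ℕ} (he : Monotone e) (heg : ∀ i, e i < g) :
    (∀ s ≤ g, ∑ i, (s - E i) = ∑ i, (s - e i)) ↔
      (∀ (i : Fin N) (h : (i : ℕ) < b), E i = e ⟨i, h⟩) ∧ ∀ h : b < N, g ≤ E ⟨b, h⟩ := by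
  constructor
  · intro H
    have hcard : ∀ s < g, (Finset.univ.filter fun j => E j ≤ s).card =
        (Finset.univ.filter fun j => e j ≤ s).card := by
      intro s hs
      have h1 := H (s + 1) hs
      rw [sum_succ_sub_eq, sum_succ_sub_eq, H s hs.le] at h1
      omega
    have hiff : ∀ s < g, ∀ (i : Fin N) (h : (i : ℕ) < b), E i ≤ s ↔ e ⟨i, h⟩ ≤ s := by
      intro s hs i h
      rw [le_iff_lt_card hE, le_iff_lt_card he, hcard s hs]
    refine ⟨fun i h => ?_, fun h => ?_⟩
    · have h1 := (hiff _ (heg ⟨i, h⟩) i h).2 le_rfl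
      exact le_antisymm h1 ((hiff _ (h1.trans_lt (heg _)) i h).1 le_rfl)
    · by_contra! hb
      have h1 := (le_iff_lt_card hE ⟨b, h⟩ _).1 le_rfl
      rw [hcard _ hb] at h1
      have h2 := Finset.card_le_univ (Finset.univ.filter fun j => e j ≤ E ⟨b, h⟩)
      rw [Fintype.card_fin] at h2
      simp only at h1
      omega
  · rintro ⟨h1, h2⟩ s hs
    symm
    refine Fintype.sum_of_injective (Fin.castLE hbN) (Fin.castLE_injective hbN) _ _ ?_ ?_
    · intro i hi
      have hib : b ≤ i := by
        by_contra! h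
        exact hi ⟨⟨i, h⟩, rfl⟩
      have h3 := h2 (hib.trans_lt i.2)
      have h4 : E ⟨b, hib.trans_lt i.2⟩ ≤ E i := hE hib
      omega
    · intro i
      rw [h1 (Fin.castLE hbN i) i.2]
      rfl

end Counting

/-! ### The strata and their truncations -/

section Strata

open MvPolynomial (aeval pderiv eval)
open PowerSeries (X coeff)

variable {k : Type*} [Field k] {N m b : ℕ}

/-- The ranks modulo `t^s`, `s ≤ g`, of the Jacobian matrix at a jet are those prescribed by the
invariants `e`. -/
def HasJacobianRanks (f : Fin m → MvPolynomial (Fin N) k) (e : Fin b → ℕ) (g : ℕ) {l : ℕ}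
    (η : Jet k N l) : Prop :=
  ∀ s ≤ g, (toeplitz (jacobian f (coeffSeries η)) s s 0).rank = ∑ i, (s - e i)

theorem hasJacobianRanks_trunc_iff (f : Fin m → MvPolynomial (Fin N) k) (e : Fin b → ℕ)
    {g l n : ℕ} (h : l ≤ n) (hg : g ≤ l + 1) (θ : Jet k N n) :
    HasJacobianRanks f e g (Jet.trunc h θ) ↔ HasJacobianRanks f e g θ :=
  forall₂_congr fun s hs => by rw [toeplitz_jacobian_trunc h f θ (hs.trans hg)]

theorem gNum_bounds (n : ℕ) : gNum n ≤ n ∧ 2 * gNum n ≤ n + 1 ∧ n ≤ 2 * gNum n := by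
  unfold gNum
  split_ifs with h
  · obtain ⟨r, rfl⟩ := h; omega
  · obtain ⟨r, rfl⟩ := Nat.not_even_iff_odd.1 h; omega

variable {n : ℕ} {f : Fin m → MvPolynomial (Fin N) k} {e : Fin b → ℕ}

/-- The condition on the invariants of a jet is a condition on ranks modulo `t^s`, `s ≤ g`. In
particular it only depends on the truncation of the jet to level `n - g`. -/
theorem mem_invariantStratum_iff (he : Monotone e) (heg : ∀ i, e i < gNum n) (hbN : b ≤ N)
    {θ : Jet k N n} :
    θ ∈ invariantStratum n f e ↔ HasJacobianRanks f e (gNum n) θ := by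
  have hg : gNum n ≤ n + 1 := by have := gNum_bounds n; omega
  constructor
  · rintro ⟨E, hE, h⟩ s hs
    rw [rank_toeplitz_of_isInvariantSeq hE (hs.trans hg)]
    exact (forall_sum_sub_eq_iff hbN hE.1 he heg).2 h s hs
  · intro h
    obtain ⟨E, hE⟩ := exists_isInvariantSeq f θ
    refine ⟨E, hE, (forall_sum_sub_eq_iff hbN hE.1 he heg).1 fun s hs => ?_⟩
    rw [← rank_toeplitz_of_isInvariantSeq hE (hs.trans hg), h s hs]

/-- An `l'`-jet over an `l`-jet `η` lies in the truncated stratum if and only if its coefficients in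
degrees greater than `l` extend to a solution of the linear system for the lifts of `η`. -/
theorem mem_truncStratum_iff (he : Monotone e) (heg : ∀ i, e i < gNum n) (hbN : b ≤ N)
    {l l' : ℕ} (hl : l ≤ l') (hl' : l' ≤ n) (hgl : n - gNum n ≤ l) {η' : Jet k N l'} :
    η' ∈ truncStratum hl' f e ↔ HasJacobianRanks f e (gNum n) (Jet.trunc hl η') ∧
      Jet.trunc hl η' ∈ jetsOn l (Ideal.span (Set.range f)) ∧
      ∃ v, (toeplitz (jacobian f (coeffSeries (Jet.trunc hl η'))) (n - l) (l' - l) 0).mulVec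
          (jetTail hl η') +
        (toeplitz (jacobian f (coeffSeries (Jet.trunc hl η'))) (n - l) (n - l') (l' - l)).mulVec v =
        -obstruction f (n - l) (Jet.trunc hl η') := by
  have hg := gNum_bounds n
  have key : ∀ θ : Jet k N n, θ ∈ jetStratum n f e ↔
      HasJacobianRanks f e (gNum n) (Jet.trunc hl (Jet.trunc hl' θ)) ∧
      Jet.trunc hl (Jet.trunc hl' θ) ∈ jetsOn l (Ideal.span (Set.range f)) ∧
      (toeplitz (jacobian f (coeffSeries (Jet.trunc hl (Jet.trunc hl' θ)))) (n - l) (l' - l)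
          0).mulVec (jetTail hl (Jet.trunc hl' θ)) +
        (toeplitz (jacobian f (coeffSeries (Jet.trunc hl (Jet.trunc hl' θ)))) (n - l) (n - l')
          (l' - l)).mulVec (jetTail hl' θ) =
        -obstruction f (n - l) (Jet.trunc hl (Jet.trunc hl' θ)) := by
    intro θ
    have hn : n ≤ 2 * l + 1 := by omega
    have htt : Jet.trunc hl (Jet.trunc hl' θ) = Jet.trunc (hl.trans hl') θ := rfl
    rw [htt, hasJacobianRanks_trunc_iff f e _ (by omega), toeplitz_jacobian_trunc _ f θ (by omega),
      toeplitz_jacobian_trunc _ f θ (by omega), ← mem_jetsOn_iff_linear hl hl' hn,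
      ← mem_invariantStratum_iff he heg hbN, and_comm]
    rfl
  constructor
  · rintro ⟨θ, hθ, rfl⟩
    obtain ⟨h1, h2, h3⟩ := (key θ).1 hθ
    exact ⟨h1, h2, _, h3⟩
  · rintro ⟨h1, h2, v, h3⟩
    refine ⟨jetGlue hl' η' v, (key _).2 ?_, trunc_jetGlue _ _ _⟩
    rw [trunc_jetGlue, jetTail_jetGlue]
    exact ⟨h1, h2, h3⟩

/-- An `l`-jet lies in the truncated stratum if and only if the linear system for its lifts is
solvable. -/
theorem mem_truncStratum_iff_exists (he : Monotone e) (heg : ∀ i, e i < gNum n) (hbN : b ≤ N)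
    {l l' : ℕ} (hl : l ≤ l') (hl' : l' ≤ n) (hgl : n - gNum n ≤ l) {η : Jet k N l} :
    η ∈ truncStratum (hl.trans hl') f e ↔ HasJacobianRanks f e (gNum n) η ∧
      η ∈ jetsOn l (Ideal.span (Set.range f)) ∧
      ∃ w v, (toeplitz (jacobian f (coeffSeries η)) (n - l) (l' - l) 0).mulVec w +
        (toeplitz (jacobian f (coeffSeries η)) (n - l) (n - l') (l' - l)).mulVec v =
        -obstruction f (n - l) η := by
  constructor
  · rintro ⟨θ, hθ, rfl⟩
    obtain ⟨h1, h2, v, h3⟩ :=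
      (mem_truncStratum_iff he heg hbN hl hl' hgl).1 ⟨θ, hθ, rfl⟩
    exact ⟨h1, h2, _, v, h3⟩
  · rintro ⟨h1, h2, w, v, h3⟩
    have : jetGlue hl η w ∈ truncStratum hl' f e := by
      rw [mem_truncStratum_iff he heg hbN hl hl' hgl, trunc_jetGlue, jetTail_jetGlue]
      exact ⟨h1, h2, v, h3⟩
    obtain ⟨θ, hθ, hθw⟩ := this
    refine ⟨θ, hθ, ?_⟩
    rw [← trunc_jetGlue hl η w, ← hθw]
    rfl

theorem exists_mulVec_eq_iff {p ι : Type*} [Fintype ι] [Fintype p] (D : Matrix p ι k) (F : p → k) :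
    (∃ w, D.mulVec w = F) ↔ (Matrix.fromCols D (Matrix.replicateCol Unit F)).rank ≤ D.rank := by
  have hle : LinearMap.range D.mulVecLin ≤
      LinearMap.range (Matrix.fromCols D (Matrix.replicateCol Unit F)).mulVecLin := by
    rintro _ ⟨w, rfl⟩
    exact ⟨Sum.elim w 0, by simp [Matrix.fromCols_mulVec]⟩
  constructor
  · rintro ⟨w, rfl⟩
    refine Submodule.finrank_mono ?_
    rintro _ ⟨u, rfl⟩
    refine ⟨u ∘ Sum.inl + u (Sum.inr ()) • w, ?_⟩
    rw [Matrix.mulVecLin_apply, Matrix.mulVecLin_apply, Matrix.fromCols_mulVec, Matrix.mulVec_add,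
      Matrix.mulVec_smul]
    congr 1
    ext i
    simp [Matrix.mulVec, dotProduct, mul_comm]
  · intro h
    have h1 : F ∈ LinearMap.range D.mulVecLin := by
      rw [Submodule.eq_of_le_of_finrank_le hle h]
      refine ⟨Sum.elim 0 1, ?_⟩
      ext i
      simp [Matrix.mulVec, dotProduct]
    exact h1

/-- The truncated strata are locally closed: the ranks of the Jacobian matrix are prescribed, and
the linear system for lifting a jet is solvable if and only if the rank of its augmented matrix does
not exceed the prescribed rank of its matrix. -/
theorem isZariskiLocallyClosed_truncStratum (he : Monotone e) (heg : ∀ i, e i < gNum n)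
    (hbN : b ≤ N) {l : ℕ} (hl : l ≤ n) (hgl : n - gNum n ≤ l) :
    IsZariskiLocallyClosed (truncStratum hl f e) := by
  have hg := gNum_bounds n
  set r : ℕ → ℕ := fun s => ∑ i, (s - e i)
  let aug : Matrix (Fin m × Fin (n - l)) ((Fin N × Fin (n - l)) ⊕ Unit)
      (MvPolynomial (Fin N × Fin (l + 1)) k) :=
    Matrix.fromCols (univToeplitz f l (n - l) (n - l) 0)
      (Matrix.replicateCol Unit (-obstruction f (n - l) MvPolynomial.X))
  have haug : ∀ η : Jet k N l, aug.map (eval η) =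
      Matrix.fromCols (toeplitz (jacobian f (coeffSeries η)) (n - l) (n - l) 0)
        (Matrix.replicateCol Unit (-obstruction f (n - l) η)) := by
    intro η
    rw [← univToeplitz_map_eval]
    ext i (j | j)
    · simp [aug]
    · simp only [aug, Matrix.map_apply, Matrix.fromCols_apply_inr, Matrix.replicateCol_apply,
        Pi.neg_apply, map_neg, obstruction, eval_coeff_aeval_univ]
  refine ⟨{η | ∀ s < gNum n + 1, r s ≤ ((univToeplitz f l s s 0).map (eval η)).rank},
    {η | (∀ s ≤ gNum n, ((univToeplitz f l s s 0).map (eval η)).rank ≤ r s) ∧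
      η ∈ jetsOn l (Ideal.span (Set.range f)) ∧ (aug.map (eval η)).rank ≤ r (n - l)},
    IsZariskiOpen.setOf_forall_lt (fun s => isZariskiOpen_le_rank _ _) _, ?_, ?_⟩
  · rw [isZariskiOpen_iff]
    intro x hx
    have hx' : (∃ s ≤ gNum n, r s + 1 ≤ ((univToeplitz f l s s 0).map (eval x)).rank) ∨
        x ∉ jetsOn l (Ideal.span (Set.range f)) ∨ r (n - l) + 1 ≤ (aug.map (eval x)).rank := by
      by_contra! H
      exact hx ⟨fun s hs => Nat.le_of_lt_succ (H.1 s hs), H.2.1, Nat.le_of_lt_succ H.2.2⟩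
    rcases hx' with ⟨s, hs, h⟩ | h | h
    · obtain ⟨q, hq, H⟩ := isZariskiOpen_iff.1 (isZariskiOpen_le_rank _ _) x h
      exact ⟨q, hq, fun y hy hy' => absurd (hy'.1 s hs) (not_le.2 (H y hy))⟩
    · rw [mem_jetsOn_span_range] at h
      simp only [PowerSeries.X_pow_dvd_iff] at h
      push Not at h
      obtain ⟨i, a, ha, h⟩ := h
      refine ⟨_, (eval_coeff_aeval_univ (f i) a x).trans_ne h, fun y hy hy' => hy ?_⟩
      rw [eval_coeff_aeval_univ]
      exact PowerSeries.X_pow_dvd_iff.1 (mem_jetsOn_span_range.1 hy'.2.1 i) a ha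
    · obtain ⟨q, hq, H⟩ := isZariskiOpen_iff.1 (isZariskiOpen_le_rank _ _) x h
      exact ⟨q, hq, fun y hy hy' => absurd hy'.2.2 (not_le.2 (H y hy))⟩
  · ext η
    rw [mem_truncStratum_iff_exists he heg hbN hl le_rfl hgl]
    simp only [Set.mem_inter_iff, Set.mem_ofPred_eq, univToeplitz_map_eval, haug]
    have hsolve : HasJacobianRanks f e (gNum n) η →
        ((∃ w v, (toeplitz (jacobian f (coeffSeries η)) (n - l) (n - l) 0).mulVec w +
          (toeplitz (jacobian f (coeffSeries η)) (n - l) (n - n) (n - l)).mulVec v =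
          -obstruction f (n - l) η) ↔
        (Matrix.fromCols (toeplitz (jacobian f (coeffSeries η)) (n - l) (n - l) 0)
        (Matrix.replicateCol Unit (-obstruction f (n - l) η))).rank ≤ r (n - l)) := by
      intro h
      have h0 : ∀ v : Fin N × Fin (n - n) → k, v = 0 := fun v => funext fun p => by
        have := p.2.2; omega
      rw [show r (n - l) = _ from (h (n - l) (by omega)).symm, ← exists_mulVec_eq_iff]
      refine exists_congr fun w => ⟨?_, fun h => ⟨0, ?_⟩⟩
      · rintro ⟨v, hv⟩
        rw [← hv, h0 v, Matrix.mulVec_zero, add_zero]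
      · rw [h, Matrix.mulVec_zero, add_zero]
    constructor
    · rintro ⟨h1, h2, h3⟩
      exact ⟨fun s hs => (h1 s (by omega)).ge, fun s hs => (h1 s hs).le, h2, (hsolve h1).1 h3⟩
    · rintro ⟨h1, h2, h3, h4⟩
      have h5 : HasJacobianRanks f e (gNum n) η := fun s hs =>
        le_antisymm (h2 s hs) (h1 s (by omega))
      exact ⟨h5, h3, (hsolve h5).2 h4⟩

/-- The truncation maps between truncated strata are trivial fibrations over a neighbourhood,
defined by the truncation to level `n - g`, of any point. -/
theorem exists_isTrivialFibration (he : Monotone e) (heg : ∀ i, e i < gNum n) (hbN : b ≤ N)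
    {l l' d : ℕ} (hl : l ≤ l') (hl' : l' ≤ n) (hgl : n - gNum n ≤ l)
    (hd : d + ∑ i, (n - l - e i) = N * (l' - l) + ∑ i, (n - l' - e i))
    {γ : Jet k N (n - gNum n)} (hγ : γ ∈ truncStratum (Nat.sub_le n (gNum n)) f e) :
    ∃ q : MvPolynomial (Fin N × Fin (n - gNum n + 1)) k, eval γ q ≠ 0 ∧
      ∀ O : Set (Jet k N (n - gNum n)), (∀ x ∈ O, eval x q ≠ 0) →
        IsTrivialFibration (Jet.trunc hl) (truncStratum hl' f e ∩ Jet.trunc (hgl.trans hl) ⁻¹' O)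
          (truncStratum (hl.trans hl') f e ∩ Jet.trunc hgl ⁻¹' O) d := by
  have hg := gNum_bounds n
  have hlin : ∀ {s}, s ≤ gNum n → ∀ (θ : Jet k N l) (q o : ℕ),
      (univToeplitz f (n - gNum n) s q o).map (eval (Jet.trunc hgl θ)) =
        toeplitz (jacobian f (coeffSeries θ)) s q o := by
    intro s hs θ q o
    rw [univToeplitz_map_eval, toeplitz_jacobian_trunc hgl f θ (by omega)]
  have hranks : ∀ x : Jet k N (n - gNum n), HasJacobianRanks f e (gNum n) x →
      ((univToeplitz f (n - gNum n) (n - l) (n - l') (l' - l)).map (eval x)).rank = ∑ i, (n - l' - e i) ∧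
      (Matrix.fromCols ((univToeplitz f (n - gNum n) (n - l) (l' - l) 0).map (eval x))
        ((univToeplitz f (n - gNum n) (n - l) (n - l') (l' - l)).map (eval x))).rank =
        ∑ i, (n - l - e i) := by
    intro x hx
    rw [univToeplitz_map_eval, univToeplitz_map_eval,
      rank_toeplitz_shift _ (show l' - l + (n - l') = n - l by omega),
      rank_fromCols_toeplitz _ (show l' - l + (n - l') = n - l by omega)]
    exact ⟨hx _ (by omega), hx _ (by omega)⟩
  have hγr : HasJacobianRanks f e (gNum n) γ :=
    ((mem_truncStratum_iff_exists he heg hbN (Nat.sub_le n (gNum n)) le_rfl le_rfl).1 hγ).1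
  obtain ⟨q, Z, T, hq, H⟩ := exists_uniform_parametrization
    (univToeplitz f (n - gNum n) (n - l) (l' - l) 0) (univToeplitz f (n - gNum n) (n - l) (n - l') (l' - l)) γ
    (hranks γ hγr).1 (hranks γ hγr).2 (d := d)
    (by rw [Fintype.card_prod, Fintype.card_fin, Fintype.card_fin]; exact hd)
  refine ⟨q, hq, fun O hO => ?_⟩
  -- The new coefficients of the lift of `η` with parameter `c`.
  let W : Jet k N l → (Fin d → k) → Fin N × Fin (l' - l) → k := fun η c =>
    (eval (Jet.trunc hgl η) q)⁻¹ • (Z.map (eval (Jet.trunc hgl η))).mulVec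
      (Sum.elim (-obstruction f (n - l) η) c)
  have HW : ∀ η : Jet k N l, Jet.trunc hgl η ∈ O → HasJacobianRanks f e (gNum n) η →
      ∀ w v, (toeplitz (jacobian f (coeffSeries η)) (n - l) (l' - l) 0).mulVec w +
        (toeplitz (jacobian f (coeffSeries η)) (n - l) (n - l') (l' - l)).mulVec v =
        -obstruction f (n - l) η →
      (∀ c, T.mulVec (W η c) = c ∧ ∃ v',
        (toeplitz (jacobian f (coeffSeries η)) (n - l) (l' - l) 0).mulVec (W η c) +
        (toeplitz (jacobian f (coeffSeries η)) (n - l) (n - l') (l' - l)).mulVec v' =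
        -obstruction f (n - l) η) ∧ W η (T.mulVec w) = w := by
    intro η hη hr w v hwv
    have hr' := hranks _ ((hasJacobianRanks_trunc_iff f e hgl (by omega) η).2 hr)
    have := H (Jet.trunc hgl η) (hO _ hη) hr'.1 hr'.2 (-obstruction f (n - l) η) w v
    rw [hlin (by omega), hlin (by omega)] at this
    exact this hwv
  refine ⟨fun η' => Sum.elim (Jet.trunc hl η') (T.mulVec (jetTail hl η')),
    fun y => jetGlue hl (y ∘ Sum.inl) (W (y ∘ Sum.inl) (y ∘ Sum.inr)), ⟨?_, ?_⟩, ⟨?_, ?_⟩, ?_, ?_,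
    fun x _ => rfl⟩
  · rintro η' ⟨⟨θ, hθ, rfl⟩, hO'⟩
    exact ⟨⟨θ, hθ, rfl⟩, hO'⟩
  · rintro (j | j)
    · exact isRegularFunOn_of_eq_div (MvPolynomial.X (j.1, Fin.castLE (by omega) j.2)) 1 (by simp)
        (fun x _ => by simp [Jet.trunc])
    · refine isRegularFunOn_of_eq_div
        (∑ p : Fin N × Fin (l' - l), MvPolynomial.C (T j p) *
          MvPolynomial.X (p.1, ⟨l + 1 + p.2, by omega⟩)) 1 (by simp) (fun x _ => ?_)
      simp [Matrix.mulVec, dotProduct, jetTail]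
  · rintro y ⟨hy, hyO⟩
    obtain ⟨h1, h2, w, v, h3⟩ := (mem_truncStratum_iff_exists he heg hbN hl hl' hgl).1 hy
    refine ⟨?_, ?_⟩
    · rw [mem_truncStratum_iff he heg hbN hl hl' hgl, trunc_jetGlue, jetTail_jetGlue]
      exact ⟨h1, h2, ((HW _ hyO h1 w v h3).1 _).2⟩
    · have : Jet.trunc (hgl.trans hl) (jetGlue hl (y ∘ Sum.inl)
          (W (y ∘ Sum.inl) (y ∘ Sum.inr))) = Jet.trunc hgl (y ∘ Sum.inl) :=
        congrArg (Jet.trunc hgl) (trunc_jetGlue hl _ _)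
      rw [Set.mem_preimage, this]
      exact hyO
  · rintro ⟨i, c⟩
    by_cases hc : (c : ℕ) < l + 1
    · exact isRegularFunOn_of_eq_div (MvPolynomial.X (Sum.inl (i, ⟨c, hc⟩))) 1 (by simp)
        (fun x _ => by simp [jetGlue, hc])
    · let ι : Fin N × Fin (n - gNum n + 1) → (Fin N × Fin (l + 1)) ⊕ Fin d :=
        fun p => Sum.inl (p.1, Fin.castLE (by omega) p.2)
      have hι : ∀ (y : (Fin N × Fin (l + 1)) ⊕ Fin d → k) p,
          eval y (MvPolynomial.rename ι p) = eval (Jet.trunc hgl (y ∘ Sum.inl)) p := by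
        intro y p
        rw [MvPolynomial.eval_rename]; rfl
      refine isRegularFunOn_of_eq_div
        (∑ t, MvPolynomial.rename ι (Z (i, ⟨c - (l + 1), by omega⟩) t) *
          Sum.elim (fun j => MvPolynomial.rename Sum.inl
            (-obstruction f (n - l) MvPolynomial.X j)) (fun j => MvPolynomial.X (Sum.inr j)) t)
        (MvPolynomial.rename ι q) (fun y hy => ?_) (fun y _ => ?_)
      · rw [hι]
        exact hO _ hy.2
      · simp only [jetGlue, hc, dif_neg, not_false_eq_true, W, Pi.smul_apply, Matrix.mulVec,
          dotProduct, smul_eq_mul, map_sum, map_mul, hι, Matrix.map_apply]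
        rw [div_eq_inv_mul]
        congr 1
        refine Finset.sum_congr rfl fun t _ => ?_
        congr 1
        rcases t with t | t
        · simp only [Sum.elim_inl, Pi.neg_apply, map_neg, MvPolynomial.eval_rename, obstruction]
          rw [eval_coeff_aeval_univ]
        · simp
  · rintro η' ⟨hη', hηO⟩
    obtain ⟨h1, h2, v, h3⟩ := (mem_truncStratum_iff he heg hbN hl hl' hgl).1 hη'
    have h4 := (HW (Jet.trunc hl η') hηO h1 _ v h3).2
    simp only [Sum.elim_comp_inl, Sum.elim_comp_inr]
    rw [h4, jetGlue_trunc_jetTail]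
  · rintro y ⟨hy, hyO⟩
    obtain ⟨h1, h2, w, v, h3⟩ := (mem_truncStratum_iff_exists he heg hbN hl hl' hgl).1 hy
    simp only [trunc_jetGlue, jetTail_jetGlue]
    rw [((HW (y ∘ Sum.inl) hyO h1 w v h3).1 (y ∘ Sum.inr)).1]
    simp

/-- If `h` consists of elements of the ideal of `X`, the kernel of the Jacobian matrix of `f` at a
jet on `X` is contained in that of `h`; if the ranks agree, the kernels are equal, and so the linear
systems for lifting jets to `h = 0` and to `X` have the same solutions. -/
theorem mem_jetStratum_of_trunc_eq {b' : ℕ} (he : Monotone e) (heg : ∀ i, e i < gNum n)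
    (hbN : b ≤ N) {θ : Jet k N n} (hθ : θ ∈ jetStratum n f e)
    {h : Fin b' → MvPolynomial (Fin N) k} (hh : ∀ i, h i ∈ Ideal.span (Set.range f))
    (hθh : θ ∈ jetStratum n h e) {α : Jet k N n} (hα : α ∈ jetStratum n h e)
    (hαθ : Jet.trunc (Nat.sub_le n (gNum n)) α = Jet.trunc (Nat.sub_le n (gNum n)) θ) :
    α ∈ jetStratum n f e := by
  have hg := gNum_bounds n
  set l := n - gNum n
  have hl : l ≤ n := Nat.sub_le n (gNum n)
  have hn : n ≤ 2 * l + 1 := by omega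
  have hθr := (mem_invariantStratum_iff he heg hbN).1 hθ.2
  have hθhr := (mem_invariantStratum_iff he heg hbN).1 hθh.2
  have hlin : ∀ {m' : ℕ} (f' : Fin m' → MvPolynomial (Fin N) k) (q o : ℕ),
      toeplitz (jacobian f' (coeffSeries α)) (n - l) q o =
        toeplitz (jacobian f' (coeffSeries θ)) (n - l) q o := by
    intro m' f' q o
    rw [← toeplitz_jacobian_trunc hl f' α (by omega), hαθ,
      toeplitz_jacobian_trunc hl f' θ (by omega)]
  have hker : LinearMap.ker (toeplitz (jacobian f (coeffSeries θ)) (n - l) (n - l) 0).mulVecLin =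
      LinearMap.ker (toeplitz (jacobian h (coeffSeries θ)) (n - l) (n - l) 0).mulVecLin := by
    apply Submodule.eq_of_le_of_finrank_eq
    · intro u hu
      rw [LinearMap.mem_ker, Matrix.mulVecLin_apply, toeplitz_mulVec_eq_zero_iff] at hu ⊢
      intro i
      have hi := hh i
      rw [pow_zero, one_mul]
      -- The derivative in the direction `u` maps the ideal of `X` to multiples of `t^(n - l)`.
      suffices H : ∀ p ∈ Ideal.span (Set.range f), X ^ (n - l) ∣
          ∑ j, aeval (coeffSeries θ) (pderiv j p) * coeffSeries u j from H _ hi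
      intro p hp
      induction hp using Submodule.span_induction with
      | mem p hp =>
        obtain ⟨i', rfl⟩ := hp
        have := hu i'
        rwa [pow_zero, one_mul] at this
      | zero => simp
      | add p p' _ _ h1 h2 =>
        simp only [map_add, add_mul, Finset.sum_add_distrib]
        exact dvd_add h1 h2
      | smul c p hp h1 =>
        have h2 : X ^ (n - l) ∣ aeval (coeffSeries θ) p :=
          (pow_dvd_pow _ (by omega)).trans ((aeval_toTuple_eq_zero_iff θ p).1 (hθ.1 p hp))
        have h3 : ∑ j, aeval (coeffSeries θ) (pderiv j (c • p)) * coeffSeries u j =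
            aeval (coeffSeries θ) c * ∑ j, aeval (coeffSeries θ) (pderiv j p) * coeffSeries u j +
            aeval (coeffSeries θ) p *
              ∑ j, aeval (coeffSeries θ) (pderiv j c) * coeffSeries u j := by
          rw [Finset.mul_sum, Finset.mul_sum, ← Finset.sum_add_distrib]
          refine Finset.sum_congr rfl fun j _ => ?_
          rw [smul_eq_mul, Derivation.leibniz]
          simp only [smul_eq_mul, map_add, map_mul]
          ring
        rw [h3]
        exact dvd_add (h1.mul_left _) (h2.mul_right _)
    · have h1 := LinearMap.finrank_range_add_finrank_ker
        (toeplitz (jacobian f (coeffSeries θ)) (n - l) (n - l) 0).mulVecLin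
      have h2 := LinearMap.finrank_range_add_finrank_ker
        (toeplitz (jacobian h (coeffSeries θ)) (n - l) (n - l) 0).mulVecLin
      have h3 := (hθr (n - l) (by omega)).trans (hθhr (n - l) (by omega)).symm
      unfold Matrix.rank at h3
      omega
  refine ⟨?_, (mem_invariantStratum_iff he heg hbN).2 ?_⟩
  · have h1 := (mem_jetsOn_iff_linear hl le_rfl hn f θ).1 hθ.1
    have h2 := (mem_jetsOn_iff_linear hl le_rfl hn h θ).1 hθh.1
    have h3 := (mem_jetsOn_iff_linear hl le_rfl hn h α).1 hα.1
    rw [mem_jetsOn_iff_linear hl le_rfl hn]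
    have h0 : ∀ v : Fin N × Fin (n - n) → k, v = 0 := fun v => funext fun p => by
      have := p.2.2; omega
    rw [h0 (jetTail _ θ), Matrix.mulVec_zero, add_zero] at h1 h2
    rw [h0 (jetTail _ α), Matrix.mulVec_zero, add_zero, hlin, hαθ] at h3 ⊢
    refine ⟨h1.1, ?_⟩
    rw [← h1.2, ← sub_eq_zero, ← Matrix.mulVec_sub]
    have h4 : jetTail hl (Jet.trunc le_rfl α) - jetTail hl (Jet.trunc le_rfl θ) ∈
        LinearMap.ker (toeplitz (jacobian h (coeffSeries θ)) (n - l) (n - l) 0).mulVecLin := by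
      rw [LinearMap.mem_ker, Matrix.mulVecLin_apply, Matrix.mulVec_sub, h3.2, h2.2, sub_self]
    rw [← hker] at h4
    exact h4
  · rw [← hasJacobianRanks_trunc_iff f e hl (by omega), hαθ,
      hasJacobianRanks_trunc_iff f e hl (by omega)]
    exact hθr

end Strata

end JetTrunc

/-! ### The structure of the truncation maps -/

theorem proposition3 {k : Type*} [Field k] [IsAlgClosed k] {N m b : ℕ} (n : ℕ)
    (f : Fin m → MvPolynomial (Fin N) k) (e : Fin b → ℕ)
    (he : Monotone e) (heg : ∀ i, e i < gNum n) (hbm : b ≤ m) (hbN : b ≤ N) :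
    -- (a)
    (∀ (l : ℕ) (hl : l ≤ n), n - gNum n ≤ l →
      IsZariskiLocallyClosed (truncStratum hl f e)) ∧
    -- (b)
    (∀ γ ∈ truncStratum (Nat.sub_le n (gNum n)) f e,
      ∃ O : Set (Jet k N (n - gNum n)), IsZariskiOpen O ∧ γ ∈ O ∧
        ∀ (l : ℕ) (hgl : n - gNum n ≤ l) (hl : l < n),
          ∃ a : ℕ,
            IsGreatest {a : ℕ | a ≤ b ∧ ∀ i : Fin b, (i : ℕ) + 1 = a → e i < n - l} a ∧
            IsTrivialFibration (Jet.trunc (Nat.le_succ l))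
              (truncStratum (Nat.succ_le_of_lt hl) f e ∩
                Jet.trunc (hgl.trans (Nat.le_succ l)) ⁻¹' O)
              (truncStratum hl.le f e ∩ Jet.trunc hgl ⁻¹' O)
              (N - a)) ∧
    -- (c)
    (∀ (l : ℕ) (hl : l < n), n - gNum n ≤ l →
      ∃ d : ℕ,
        IsLocallyTrivialFibration (Jet.trunc hl.le) (jetStratum n f e)
          (truncStratum hl.le f e) d ∧
        (l = n - gNum n →
          ⌈((N : ℚ) - b) * ((n : ℚ) / 2)⌉₊ ≤ d ∧
          ((n : ℚ) / 2 ≤ ∑ i, (e i : ℚ) → ⌈((N : ℚ) - b + 1) * ((n : ℚ) / 2)⌉₊ ≤ d))) ∧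
    -- (d)
    (∀ θ ∈ jetStratum n f e, ∀ h : Fin b → MvPolynomial (Fin N) k,
      (∀ i, h i ∈ Ideal.span (Set.range f)) → θ ∈ jetStratum n h e →
      ∀ α ∈ jetStratum n h e,
        Jet.trunc (Nat.sub_le n (gNum n)) α = Jet.trunc (Nat.sub_le n (gNum n)) θ →
        α ∈ jetStratum n f e) := by
  have hg := gNum_bounds n
  refine ⟨fun l hl hgl => isZariskiLocallyClosed_truncStratum he heg hbN hl hgl, fun γ hγ => ?_,
    fun l hl hgl => ?_, fun θ hθ h hh hθh α hα hαθ =>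
      mem_jetStratum_of_trunc_eq he heg hbN hθ hh hθh hα hαθ⟩
  · have key : ∀ l, ∃ q : MvPolynomial (Fin N × Fin (n - gNum n + 1)) k,
        MvPolynomial.eval γ q ≠ 0 ∧ ∀ (hgl : n - gNum n ≤ l) (hl : l < n)
          (O : Set (Jet k N (n - gNum n))), (∀ x ∈ O, MvPolynomial.eval x q ≠ 0) →
          IsTrivialFibration (Jet.trunc (Nat.le_succ l))
            (truncStratum (Nat.succ_le_of_lt hl) f e ∩
              Jet.trunc (hgl.trans (Nat.le_succ l)) ⁻¹' O)
            (truncStratum hl.le f e ∩ Jet.trunc hgl ⁻¹' O)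
            (N - (Finset.univ.filter fun i => e i ≤ n - (l + 1)).card) := by
      intro l
      by_cases hgl : n - gNum n ≤ l ∧ l < n
      · obtain ⟨hgl, hl⟩ := hgl
        have hcard := Finset.card_le_univ (Finset.univ.filter fun i => e i ≤ n - (l + 1))
        rw [Fintype.card_fin] at hcard
        have hd := sum_succ_sub_eq e (n - (l + 1))
        rw [show n - (l + 1) + 1 = n - l by omega] at hd
        obtain ⟨q, hq, H⟩ := exists_isTrivialFibration he heg hbN (Nat.le_succ l)
          (Nat.succ_le_of_lt hl) hgl
          (d := N - (Finset.univ.filter fun i => e i ≤ n - (l + 1)).card)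
          (by rw [Nat.succ_eq_add_one, Nat.add_sub_cancel_left, mul_one, hd]; omega) hγ
        exact ⟨q, hq, fun _ _ => H⟩
      · exact ⟨1, by simp, fun h1 h2 => absurd ⟨h1, h2⟩ hgl⟩
    choose q hq H using key
    refine ⟨_, isZariskiOpen_eval_ne_zero (∏ l ∈ Finset.range n, q l), ?_, fun l hgl hl =>
      ⟨_, ?_, H l hgl hl _ fun x hx => ?_⟩⟩
    · change MvPolynomial.eval γ _ ≠ 0
      rw [map_prod]
      exact Finset.prod_ne_zero_iff.2 fun l _ => hq l
    · have hiff : ∀ i, e i < n - l ↔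
          (i : ℕ) < (Finset.univ.filter fun i => e i ≤ n - (l + 1)).card := fun i => by
        rw [← le_iff_lt_card he]; omega
      have hcard := Finset.card_le_univ (Finset.univ.filter fun i => e i ≤ n - (l + 1))
      rw [Fintype.card_fin] at hcard
      refine ⟨⟨hcard, fun i hi => (hiff i).2 (by omega)⟩, fun a ha => ?_⟩
      rcases Nat.eq_zero_or_pos a with rfl | ha0
      · exact Nat.zero_le _
      · have h1 := (hiff ⟨a - 1, by have := ha.1; omega⟩).1 (ha.2 _ (by simp only; omega))
        simp only at h1
        omega
    · change MvPolynomial.eval x _ ≠ 0 at hx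
      rw [map_prod] at hx
      exact Finset.prod_ne_zero_iff.1 hx l (Finset.mem_range.2 hl)
  · have hle : ∑ i, (n - l - e i) ≤ N * (n - l) := by
      calc ∑ i, (n - l - e i) ≤ ∑ _i : Fin b, (n - l) :=
            Finset.sum_le_sum fun i _ => Nat.sub_le _ _
        _ ≤ N * (n - l) := by simpa using Nat.mul_le_mul_right _ hbN
    refine ⟨N * (n - l) - ∑ i, (n - l - e i), ⟨?_, fun w hw => ?_⟩, fun hln => ?_⟩
    · intro θ hθ
      exact ⟨θ, hθ, rfl⟩
    · have hγ : Jet.trunc hgl w ∈ truncStratum (Nat.sub_le n (gNum n)) f e := by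
        obtain ⟨θ, hθ, rfl⟩ := hw
        exact ⟨θ, hθ, rfl⟩
      obtain ⟨q, hq, H⟩ := exists_isTrivialFibration he heg hbN hl.le le_rfl hgl
        (d := N * (n - l) - ∑ i, (n - l - e i)) (by simp; omega) hγ
      have hstrat : truncStratum (le_refl n) f e = jetStratum n f e := Set.image_id _
      have H' := H {x | MvPolynomial.eval x q ≠ 0} fun x hx => hx
      rw [hstrat] at H'
      refine ⟨Jet.trunc hgl ⁻¹' {x | MvPolynomial.eval x q ≠ 0}, ?_, hq, H'⟩
      let ι : Fin N × Fin (n - gNum n + 1) → Fin N × Fin (l + 1) :=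
        fun p => (p.1, Fin.castLE (by omega) p.2)
      convert isZariskiOpen_eval_ne_zero (MvPolynomial.rename ι q) using 1
      ext x
      simp only [Set.mem_preimage, Set.mem_ofPred_eq, MvPolynomial.eval_rename]
      rfl
    · -- For `l = n - g` the dimension is `(N - b) g + ∑ e i`, and `g ≥ n / 2`.
      have hng : n - l = gNum n := by omega
      have hdim : ((N * (n - l) - ∑ i, (n - l - e i) : ℕ) : ℚ) =
          ((N : ℚ) - b) * gNum n + ∑ i, (e i : ℚ) := by
        rw [Nat.cast_sub hle, hng]
        have : ∀ i, ((gNum n - e i : ℕ) : ℚ) = gNum n - e i := fun i =>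
          Nat.cast_sub (heg i).le
        simp only [Nat.cast_mul, Nat.cast_sum, this, Finset.sum_sub_distrib, Finset.sum_const,
          Finset.card_univ, Fintype.card_fin, nsmul_eq_mul]
        ring
      have hNb : (0 : ℚ) ≤ (N : ℚ) - b := by
        rw [sub_nonneg]; exact_mod_cast hbN
      have hgn : (n : ℚ) / 2 ≤ gNum n := by
        have : (n : ℚ) ≤ 2 * gNum n := by exact_mod_cast hg.2.2
        linarith
      have hmul := mul_le_mul_of_nonneg_left hgn hNb
      have hsum : (0 : ℚ) ≤ ∑ i, (e i : ℚ) := Finset.sum_nonneg fun i _ => Nat.cast_nonneg _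
      refine ⟨Nat.ceil_le.2 ?_, fun hE => Nat.ceil_le.2 ?_⟩
      · rw [hdim]; linarith
      · rw [hdim, add_mul, one_mul]; linarith
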